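/- Consider the MISO broadcast channel $y_k=\mathbf h_k^{H}\mathbf x+w_k$ with $L\ge 1$ transmit antennas, average power $P$ and noise $w_k\sim\mathcal{CN}(0,1)$, with a library of $N$ files of $F$ bits. There are $K_1\ge 1$ cache-aided users, each able to store a fraction $\gamma_1\in(0,1)$ of the library, with $K_1\gamma_1\in\mathbb N$, and $K_2$ cache-less users, and $K_1+K_2\le N$. The fixed channel vectors are known everywhere and in general position (those of any at most $L$ users are linearly independent). Cache placement is uncoded (library bits are stored as they are, before the demands are known), and each user requests a different file. A normalized delay $T$ is achievable if for every $\delta>0$ and all sufficiently large $P$ there are, for every $\eta>0$, schemes that serve all such demands with error probability at most $\eta$ at each user, in $n$ channel uses with $n\log_2 P/F\le T+\delta$. Put $$T_{K_1}=\frac{K_1(1-\gamma_1)}{1+K_1\gamma_1}.$$ (i) In the single-antenna system with the $K_1$ cache-aided users only (and nonzero channels), the smallest achievable delay is $T_{K_1}$. (ii) Adding $L-1$ transmit antennas allows the addition of $K_2=(L-1)T_{K_1}$ cache-less users (and of any smaller number, if $(L-1)T_{K_1}$ is not an integer) with no increase in delay: if $K_2\le (L-1)T_{K_1}$, and $T_{K_1}\ge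 1$ or $K_2=0$, then the delay $T_{K_1}$ is achievable in the $L$-antenna system with the $K_1$ cache-aided and the $K_2$ cache-less users. (iii) $(L-1)T_{K_1}\approx\frac{L-1}{\gamma_1}$, namely $$(L-1)T_{K_1}=\frac{L-1}{\gamma_1}\Bigl(1-\gamma_1-\frac{1-\gamma_1}{1+K_1\gamma_1}\Bigr),$$ so that $(L-1)T_{K_1}\sim\frac{L-1}{\gamma_1}$ as $\gamma_1\to0^+$ and $K_1\gamma_1\to\infty$. -/

import Mathlib

open MeasureTheory ProbabilityTheory Filter Topology Asymptotics

noncomputable section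

/-- The circularly symmetric complex Gaussian law of mean `0` and variance `1`: independent real
and imaginary parts, each of variance `1/2`. -/
def complexGaussian : Measure ℂ :=
  ((gaussianReal 0 (1 / 2)).prod (gaussianReal 0 (1 / 2))).map
    Complex.measurableEquivRealProd.symm

/-- `K₁` users of the first type and `K₂` users of the second type. -/
abbrev User (K₁ K₂ : ℕ) : Type := Fin K₁ ⊕ Fin K₂

/-- A library of `N` files of `F` bits each. -/
abbrev Library (N F : ℕ) : Type := Fin N → Fin F → Bool

/-- The channel vectors `h_k ∈ ℂ^L` of the users. -/
abbrev Channel (L K₁ K₂ : ℕ) : Type := User K₁ K₂ → Fin L → ℂ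

/-- The channel vectors of any at most `L` users are linearly independent. -/
def InGeneralPosition {L K₁ K₂ : ℕ} (H : Channel L K₁ K₂) : Prop :=
  ∀ S : Finset (User K₁ K₂), S.card ≤ L → LinearIndependent ℂ (fun k : S => H k)

/-- A caching and delivery scheme with uncoded placement, for `L` transmit antennas,
files of `F` bits and `n` channel uses. The placement is made before the demands are known:
user `k` stores the library bits at the positions in `cache k`. Given the demands, the transmitter
maps the library to `n` transmit vectors in `ℂ^L`, and user `k` estimates its
requested file from its cached bits and its `n` received symbols. -/
structure Scheme (L K₁ K₂ N F n : ℕ) where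
  cache : User K₁ K₂ → Finset (Fin N × Fin F)
  encode : (User K₁ K₂ → Fin N) → Library N F → Fin n → Fin L → ℂ
  decode : (User K₁ K₂ → Fin N) → (k : User K₁ K₂) → (cache k → Bool) → (Fin n → ℂ) →
    Fin F → Bool
  measurable_decode : ∀ d k c, Measurable (decode d k c)

namespace Scheme

variable {L K₁ K₂ N F n : ℕ}

/-- Users of the first (second) type cache at most a fraction `γ₁` (`γ₂`) of the library. -/
def CacheConstraint (s : Scheme L K₁ K₂ N F n) (γ₁ γ₂ : ℝ) : Prop :=
  (∀ i : Fin K₁, ((s.cache (Sum.inl i)).card : ℝ) ≤ γ₁ * (N * F)) ∧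
  (∀ j : Fin K₂, ((s.cache (Sum.inr j)).card : ℝ) ≤ γ₂ * (N * F))

/-- The power of the transmit vectors, averaged over uniform library contents and over
the channel uses, is at most `P`, for any demands of different files. -/
def PowerConstraint (s : Scheme L K₁ K₂ N F n) (P : ℝ) : Prop :=
  ∀ d : User K₁ K₂ → Fin N, Function.Injective d →
    (∑ W : Library N F, ∑ i : Fin n, ∑ l : Fin L, ‖s.encode d W i l‖ ^ 2) /
      (Fintype.card (Library N F) : ℝ) ≤ n * P

/-- The symbols `h_kᴴ x + w` received by user `k`, for library `W` and noise `w`. -/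
def received (s : Scheme L K₁ K₂ N F n) (H : Channel L K₁ K₂) (d : User K₁ K₂ → Fin N)
    (W : Library N F) (k : User K₁ K₂) (w : Fin n → ℂ) : Fin n → ℂ :=
  fun i => (∑ l : Fin L, (starRingEnd ℂ) (H k l) * s.encode d W i l) + w i

/-- The output of user `k`, for library `W` and noise `w`. -/
def output (s : Scheme L K₁ K₂ N F n) (H : Channel L K₁ K₂) (d : User K₁ K₂ → Fin N)
    (W : Library N F) (k : User K₁ K₂) (w : Fin n → ℂ) : Fin F → Bool :=
  s.decode d k (fun p => W p.1.1 p.1.2) (s.received H d W k w)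

/-- The probability that user `k` does not recover its requested file, for uniform
library contents and independent standard complex Gaussian noise in every channel use. -/
def errorProb (s : Scheme L K₁ K₂ N F n) (H : Channel L K₁ K₂) (d : User K₁ K₂ → Fin N)
    (k : User K₁ K₂) : ℝ :=
  (∑ W : Library N F,
      (Measure.pi (fun _ : Fin n => complexGaussian)).real {w | s.output H d W k w ≠ W (d k)}) /
    (Fintype.card (Library N F) : ℝ)

end Scheme

/-- The normalized delay `T` is achievable with uncoded placement over the channel `H`, with
`N` files and normalized cache sizes `γ₁`, `γ₂`. The unit of time is the duration of `F / log₂ P`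
channel uses, in which a link of capacity `log₂ P` carries one file. For every slack `δ > 0` and
all sufficiently large powers `P`, there are schemes of arbitrarily small error
probability, for all demands of different files, that take time at most `T + δ`. -/
def IsAchievableDelay {L K₁ K₂ : ℕ} (N : ℕ) (γ₁ γ₂ : ℝ) (H : Channel L K₁ K₂) (T : ℝ) : Prop :=
  ∀ δ : ℝ, 0 < δ → ∀ᶠ P : ℝ in atTop, ∀ η : ℝ, 0 < η →
    ∃ (F n : ℕ) (s : Scheme L K₁ K₂ N F n), 0 < F ∧
      s.CacheConstraint γ₁ γ₂ ∧ s.PowerConstraint P ∧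
      (∀ d : User K₁ K₂ → Fin N, Function.Injective d → ∀ k, s.errorProb H d k ≤ η) ∧
      (n : ℝ) * Real.logb 2 P / F ≤ T + δ

/-- `T_K = K (1 - γ) / (1 + K γ)`. -/
def singleStreamDelay (K : ℕ) (γ : ℝ) : ℝ := K * (1 - γ) / (1 + K * γ)

/-- The regime of pairs `(K, γ)` with `γ → 0⁺` and `K γ → ∞`. -/
def smallCacheRegime : Filter (ℕ × ℝ) :=
  comap (fun p : ℕ × ℝ => (p.1 : ℝ) * p.2) atTop ⊓ comap Prod.snd (𝓝[>] (0 : ℝ))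

end

/-! Put `t = K₁ * γ₁` and `g = K₁ - t`, so that the delay in question is `g / (t + 1)`.

Achievability combines coded caching with zero-forcing. A file is cut into pieces `(τ, r)`, where
`τ` is a `t`-set of cache-aided users, who all store the piece, and `r < g`. A slot is a pair of a
`(t+1)`-set `χ` and some `r < g`. It carries the sum over `k ∈ χ` of the pieces `χ \ {k}` requested
by `k`, beamed to vanish at the cache-less users served in the slot. On top of it go uncoded pieces
for these users: a piece with `τ = χ \ {κ}` is known to all of `χ` except `κ`, so its beam has to
vanish only at `κ` and at the other cache-less users served. Every beam thus has at most `L - 1`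
zeros as long as at most `L - 1` cache-less users are served per slot, which a cyclic assignment of
jobs to slots ensures (`card_jobs_le`, `isAchievableDelay_of_schedule`). The ratio of slots to
pieces is `g / (t + 1)`. Each stream carries `log₂ P - O(1)` bits per channel use by greedily packed
codes on a Gaussian integer grid (`exists_code`, `isAchievableDelay_of_slots`).

For the converse with one antenna, order the users and let each decode with the help of the files
decoded before. The requested bits that are not cached by their requester or any earlier user are
then determined by the rest of the library (`Scheme.recoverable_chainBits`). Averaged over orderings
and cyclic demands, a bit cached by `s` of `K` users counts `(K - s) / (s + 1)` times; by convexity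
some choice leaves `F * (K - t) / (t + 1)` such bits (`exists_card_chainBits_ge`). All received
signals are scaled copies of one scalar sequence plus noise, so `n` uses convey at most `n * (log P
+ O(1))` nats (`recoverable_card_le`). This is proved by a Gibbs inequality (`mul_success_le`) that
compares the true output law with a mixture centred at quantized signals. -/

/-! ### Zero-forcing beams, greedy packing and a geometric sum. -/

section Combinatorics

/-- A vector that is orthogonal to exactly the channels in a small set. -/
theorem InGeneralPosition.exists_beam {L K₁ K₂ : ℕ} {H : Channel L K₁ K₂}
    (hH : InGeneralPosition H) (A : Finset (User K₁ K₂)) (hA : A.card < L) :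
    ∃ v : Fin L → ℂ, (∀ k ∈ A, ∑ l, (starRingEnd ℂ) (H k l) * v l = 0) ∧
      ∀ k ∉ A, ∑ l, (starRingEnd ℂ) (H k l) * v l ≠ 0 := by
  classical
  have key : ∀ k ∉ A, ∃ v : Fin L → ℂ, (∀ j ∈ A, ∑ l, (starRingEnd ℂ) (H j l) * v l = 0) ∧
      ∑ l, (starRingEnd ℂ) (H k l) * v l ≠ 0 := by
    intro k hk
    have hli : LinearIndependent ℂ (fun j : (insert k A : Finset (User K₁ K₂)) => H j) :=
      hH _ (by rw [Finset.card_insert_of_notMem hk]; omega)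
    set W : Submodule ℂ (Fin L → ℂ) := Submodule.span ℂ (H '' A) with hW
    have hkW : H k ∉ W := by
      have := hli.notMem_span_image (s := {j | (j : User K₁ K₂) ∈ A})
        (x := ⟨k, Finset.mem_insert_self k A⟩) (by simpa using hk)
      intro h
      apply this
      convert h using 2
      ext x
      simp only [Set.mem_image, Set.mem_ofPred_eq]
      constructor
      · rintro ⟨j, hj, rfl⟩
        exact ⟨j, hj, rfl⟩
      · rintro ⟨j, hj, rfl⟩
        exact ⟨⟨j, Finset.mem_insert_of_mem hj⟩, hj, rfl⟩
    obtain ⟨f, hf, hfW⟩ := Submodule.exists_le_ker_of_notMem hkW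
    -- The channel enters the pairing conjugated, so conjugating the coordinates of `f` turns the
    -- pairing with `x` into the conjugate of `f x`.
    refine ⟨fun l => (starRingEnd ℂ) (f (Pi.single l 1)), ?_, ?_⟩
    all_goals
      have hfx : ∀ x : Fin L → ℂ, ∑ l, (starRingEnd ℂ) (x l) *
          (starRingEnd ℂ) (f (Pi.single l 1)) = (starRingEnd ℂ) (f x) := by
        intro x
        conv_rhs => rw [pi_eq_sum_univ' x]
        simp [map_sum]
    · intro j hj
      rw [hfx]
      have : H j ∈ LinearMap.ker f := hfW (Submodule.subset_span ⟨j, hj, rfl⟩)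
      simpa using this
    · rw [hfx]
      simpa using hf
  let φ : User K₁ K₂ → (Fin L → ℂ) →ₗ[ℂ] ℂ := fun k =>
    ∑ l, (starRingEnd ℂ) (H k l) • LinearMap.proj l
  have hφ : ∀ k v, φ k v = ∑ l, (starRingEnd ℂ) (H k l) * v l := by
    intro k v
    simp [φ]
  let V : Submodule ℂ (Fin L → ℂ) := ⨅ k ∈ A, LinearMap.ker (φ k)
  have hV : ∀ v, v ∈ V ↔ ∀ k ∈ A, φ k v = 0 := by
    intro v
    simp [V, Submodule.mem_iInf]
  -- A vector space over an infinite field is not a finite union of proper subspaces, so one vector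
  -- of `V` avoids all these kernels at once.
  have hcov : ∃ v : V, ∀ k : {k // k ∉ A}, φ k v ≠ 0 := by
    by_contra! hcon
    obtain ⟨k, hk⟩ := Subspace.exists_eq_top_of_iUnion_eq_univ
      (p := fun k : {k // k ∉ A} => LinearMap.ker ((φ k).comp V.subtype)) (by
        ext v
        simpa using hcon v)
    obtain ⟨v, hv, hv'⟩ := key k k.2
    have hvV : v ∈ V := (hV v).2 fun j hj => by rw [hφ, hv j hj]
    have : (⟨v, hvV⟩ : V) ∈ LinearMap.ker ((φ k).comp V.subtype) := by rw [hk]; trivial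
    apply hv'
    rw [← hφ]
    simpa using this
  obtain ⟨v, hv⟩ := hcov
  refine ⟨v, fun k hk => ?_, fun k hk => ?_⟩
  · rw [← hφ]; exact (hV v).1 v.2 k hk
  · rw [← hφ]; exact hv ⟨k, hk⟩

/-- Greedy packing: if every point of a finite type is near at most `B` points and `M * B` does
not exceed the number of points, then some `M` points are pairwise not near. -/
theorem exists_packing {X : Type*} [Fintype X] [Nonempty X] (near : X → X → Prop) (hrefl : ∀ x, near x x)
    (hsymm : ∀ x y, near x y → near y x) (B : ℕ)
    (hB : ∀ x, {y | near x y}.ncard ≤ B) (M : ℕ) (hM : M * B ≤ Fintype.card X) :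
    ∃ f : Fin M → X, ∀ i j, near (f i) (f j) → i = j := by
  classical
  obtain ⟨x₀⟩ := ‹Nonempty X›
  have hB1 : 1 ≤ B := le_trans (by
    rw [Nat.one_le_iff_ne_zero, Ne, Set.ncard_eq_zero]
    exact Set.Nonempty.ne_empty ⟨x₀, hrefl x₀⟩) (hB x₀)
  induction M with
  | zero => exact ⟨Fin.elim0, fun i => i.elim0⟩
  | succ M ih =>
    obtain ⟨f, hf⟩ := ih (le_trans (Nat.mul_le_mul_right _ (Nat.le_succ M)) hM)
    -- The neighbourhoods of the `M` chosen points cover at most `M * B < (M + 1) * B` points.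
    have hx : ∃ x, ∀ i, ¬ near (f i) x := by
      by_contra! hcon
      have h1 : (Finset.univ : Finset X) ⊆
          Finset.univ.biUnion fun i => {y | near (f i) y}.toFinset := by
        intro x _
        obtain ⟨i, hi⟩ := hcon x
        simp only [Finset.mem_biUnion, Finset.mem_univ, true_and, Set.mem_toFinset]
        exact ⟨i, hi⟩
      have h2 := (Finset.card_le_card h1).trans (Finset.card_biUnion_le)
      have h3 : ∑ i, ({y | near (f i) y}.toFinset).card ≤ ∑ _i : Fin M, B :=
        Finset.sum_le_sum fun i _ => by
          rw [← Set.ncard_eq_toFinset_card']; exact hB _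
      simp only [Finset.card_univ, Finset.sum_const, smul_eq_mul, Fintype.card_fin] at h2 h3
      have : (M + 1) * B = M * B + B := by ring
      omega
    obtain ⟨x, hx⟩ := hx
    refine ⟨Fin.snoc f x, fun i j => ?_⟩
    refine Fin.lastCases ?_ (fun i => ?_) i <;> refine Fin.lastCases ?_ (fun j => ?_) j
    · simp
    · simp only [Fin.snoc_last, Fin.snoc_castSucc]
      exact fun h => absurd (hsymm _ _ h) (hx j)
    · simp only [Fin.snoc_last, Fin.snoc_castSucc]
      exact fun h => absurd h (hx i)
    · simp only [Fin.snoc_castSucc]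
      exact fun h => congrArg _ (hf i j h)

/-- Sums of `exp (-a |k|)` over sets of integers. -/
theorem sum_exp_neg_abs_le (a : ℝ) (ha : 0 < a) (S : Finset ℤ) :
    ∑ k ∈ S, Real.exp (-(a * |(k : ℝ)|)) ≤ 2 * (1 + 1 / a) := by
  set r := Real.exp (-a) with hr
  have hr0 : 0 ≤ r := (Real.exp_pos _).le
  have hr1 : r < 1 := by rw [hr, Real.exp_lt_one_iff]; linarith
  have hexp : ∀ k : ℤ, Real.exp (-(a * |(k : ℝ)|)) = r ^ k.natAbs := by
    intro k
    rw [hr, ← Real.exp_nat_mul, Nat.cast_natAbs, Int.cast_abs]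
    ring_nf
  obtain ⟨n, hn⟩ : ∃ n : ℕ, ∀ k ∈ S, k.natAbs < n :=
    ⟨S.sup Int.natAbs + 1, fun k hk => Nat.lt_succ_of_le (Finset.le_sup hk)⟩
  have hfib : ∑ k ∈ S, r ^ k.natAbs ≤ ∑ i ∈ Finset.range n, 2 * r ^ i := by
    rw [← Finset.sum_fiberwise_of_maps_to (g := Int.natAbs) (t := Finset.range n)
      (fun k hk => Finset.mem_range.2 (hn k hk))]
    refine Finset.sum_le_sum fun i _ => ?_
    have : ∑ k ∈ S with k.natAbs = i, r ^ k.natAbs =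
        (S.filter fun k => k.natAbs = i).card * r ^ i := by
      rw [← nsmul_eq_mul, ← Finset.sum_const]
      refine Finset.sum_congr rfl fun k hk => by rw [(Finset.mem_filter.1 hk).2]
    rw [this]
    have hc : (S.filter fun k => k.natAbs = i).card ≤ 2 := by
      refine le_trans (Finset.card_le_card (t := {(i : ℤ), -(i : ℤ)}) fun k hk => ?_)
        Finset.card_le_two
      have := (Finset.mem_filter.1 hk).2
      simp only [Finset.mem_insert, Finset.mem_singleton]
      omega
    have hc' : ((S.filter fun k => k.natAbs = i).card : ℝ) ≤ 2 := by exact_mod_cast hc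
    exact mul_le_mul_of_nonneg_right hc' (pow_nonneg hr0 _)
  simp_rw [hexp]
  refine hfib.trans ?_
  rw [← Finset.mul_sum]
  have hgeom : ∑ i ∈ Finset.range n, r ^ i ≤ 1 / (1 - r) := by
    rw [one_div, ← tsum_geometric_of_lt_one hr0 hr1]
    exact (summable_geometric_of_lt_one hr0 hr1).sum_le_tsum _ fun i _ => pow_nonneg hr0 i
  have hinv : 1 / (1 - r) ≤ 1 + 1 / a := by
    have h1 : r * (1 + a) ≤ 1 := by
      have := Real.add_one_le_exp a
      have h2 : r * Real.exp a = 1 := by rw [hr, ← Real.exp_add]; simp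
      nlinarith
    rw [div_le_iff₀ (by linarith)]
    field_simp
    nlinarith
  linarith

end Combinatorics

/-! ### Gaussian noise: energy concentration and densities of translates. -/

section Noise

instance : IsProbabilityMeasure complexGaussian := by
  unfold complexGaussian
  exact Measure.isProbabilityMeasure_map (by fun_prop)

theorem integrable_complexGaussian_iff {f : ℂ → ℝ} (hf : Measurable f) :
    Integrable f complexGaussian ↔ Integrable (fun p : ℝ × ℝ => f ⟨p.1, p.2⟩)
      ((gaussianReal 0 (1 / 2)).prod (gaussianReal 0 (1 / 2))) := by
  unfold complexGaussian
  rw [integrable_map_measure hf.aestronglyMeasurable (by fun_prop)]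
  rfl

theorem integral_complexGaussian {f : ℂ → ℝ} (hf : Measurable f) :
    ∫ w, f w ∂complexGaussian = ∫ p : ℝ × ℝ, f ⟨p.1, p.2⟩
      ∂((gaussianReal 0 (1 / 2)).prod (gaussianReal 0 (1 / 2))) := by
  unfold complexGaussian
  rw [integral_map (by fun_prop) hf.aestronglyMeasurable]
  rfl

/-- Fernique's theorem applies to each real coordinate, and independence lets the two exponentials
multiply. -/
theorem exists_integrable_exp_norm_sq :
    ∃ c : ℝ, 0 < c ∧ Integrable (fun w : ℂ => Real.exp (c * ‖w‖ ^ 2)) complexGaussian := by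
  obtain ⟨c, hc, hint⟩ := IsGaussian.exists_integrable_exp_sq (gaussianReal 0 (1 / 2))
  refine ⟨c, hc, (integrable_complexGaussian_iff (by fun_prop)).2 ?_⟩
  convert hint.mul_prod hint using 2 with p
  rw [← Real.exp_add, Complex.sq_norm, Complex.normSq_apply]
  simp only [Real.norm_eq_abs, sq_abs]
  ring_nf

/-- The noise energy of `n` channel uses exceeds a multiple of `n` with vanishing probability. -/
theorem exists_noise_energy_bound :
    ∃ C : ℝ, 0 < C ∧ ∀ η : ℝ, 0 < η → ∀ᶠ n : ℕ in atTop,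
      (Measure.pi fun _ : Fin n => complexGaussian).real {w | n * C < ∑ i, ‖w i‖ ^ 2} ≤ η := by
  obtain ⟨c, hc, hint⟩ := exists_integrable_exp_norm_sq
  set M := ∫ w, Real.exp (c * ‖w‖ ^ 2) ∂complexGaussian with hM
  have hM1 : 1 ≤ M := by
    have : ∫ _ : ℂ, (1 : ℝ) ∂complexGaussian ≤ M :=
      integral_mono (integrable_const _) hint fun w => Real.one_le_exp (by positivity)
    simpa using this
  have hlog : 0 ≤ Real.log M := Real.log_nonneg hM1
  -- Chernoff bound: the exponential of `c` times the energy has mean `M ^ n`, so this constant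
  -- makes Markov's inequality give `exp (-n)`.
  refine ⟨(Real.log M + 1) / c, by positivity, fun η hη => ?_⟩
  have hlim : Tendsto (fun n : ℕ => Real.exp (-1) ^ n) atTop (𝓝 0) :=
    tendsto_pow_atTop_nhds_zero_of_lt_one (Real.exp_pos _).le (by
      rw [Real.exp_lt_one_iff]; norm_num)
  filter_upwards [hlim.eventually_le_const hη] with n hn
  refine le_trans ?_ hn
  have hprod : Integrable (fun w : Fin n → ℂ => ∏ i, Real.exp (c * ‖w i‖ ^ 2))
      (Measure.pi fun _ : Fin n => complexGaussian) := Integrable.fintype_prod fun _ => hint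
  have hint' : ∫ w : Fin n → ℂ, ∏ i, Real.exp (c * ‖w i‖ ^ 2)
      ∂(Measure.pi fun _ : Fin n => complexGaussian) = M ^ n := by
    rw [integral_fintype_prod_eq_prod (fun (_ : Fin n) (z : ℂ) => Real.exp (c * ‖z‖ ^ 2))]
    simp [hM]
  have hmarkov := mul_meas_ge_le_integral_of_nonneg
    (ae_of_all _ fun w => Finset.prod_nonneg fun i _ => (Real.exp_pos _).le) hprod
    (Real.exp (n * (Real.log M + 1)))
  rw [hint'] at hmarkov
  have hsub : (Measure.pi fun _ : Fin n => complexGaussian).real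
      {w | n * ((Real.log M + 1) / c) < ∑ i, ‖w i‖ ^ 2} ≤
      (Measure.pi fun _ : Fin n => complexGaussian).real
      {w | Real.exp (n * (Real.log M + 1)) ≤ ∏ i, Real.exp (c * ‖w i‖ ^ 2)} := by
    refine measureReal_mono fun w hw => ?_
    simp only [Set.mem_ofPred_eq] at hw ⊢
    rw [← Real.exp_sum, ← Finset.mul_sum]
    apply Real.exp_le_exp.2
    rw [← mul_div_assoc, div_lt_iff₀ hc] at hw
    linarith
  refine hsub.trans ?_
  rw [← mul_le_mul_iff_right₀ (Real.exp_pos (n * (Real.log M + 1)))]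
  refine hmarkov.trans (le_of_eq ?_)
  rw [← Real.exp_nat_mul, ← Real.exp_add]
  have : M ^ n = Real.exp (n * Real.log M) := by
    rw [Real.exp_nat_mul, Real.exp_log (by linarith)]
  rw [this]
  ring_nf

theorem integrable_norm_sq_complexGaussian : Integrable (fun w : ℂ => ‖w‖ ^ 2) complexGaussian := by
  obtain ⟨c, hc, hint⟩ := exists_integrable_exp_norm_sq
  refine (hint.div_const c).mono (by fun_prop) (ae_of_all _ fun w => ?_)
  rw [Real.norm_of_nonneg (by positivity), Real.norm_of_nonneg (by positivity),
    le_div_iff₀ hc]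
  have := Real.add_one_le_exp (c * ‖w‖ ^ 2)
  linarith

theorem integrable_id_complexGaussian : Integrable (fun w : ℂ => w) complexGaussian := by
  refine (integrable_norm_sq_complexGaussian.add (integrable_const 1)).mono
    (by fun_prop) (ae_of_all _ fun w => ?_)
  simp only [Pi.add_apply]
  rw [Real.norm_of_nonneg (by positivity)]
  nlinarith [sq_nonneg (‖w‖ - 1)]

/-- `T` pushes the measure with density `g` relative to `μ` back to `μ`. -/
def IsDensityShift {E : Type*} [MeasurableSpace E] (μ : Measure E) (T : E → E) (g : E → ℝ) :
    Prop :=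
  Measurable T ∧ Measurable g ∧ (∀ x, 0 ≤ g x) ∧
    (μ.withDensity fun x => ENNReal.ofReal (g x)).map T = μ

theorem lintegral_fintype_prod_eq_prod {ι : Type*} [Fintype ι] {E : ι → Type*}
    [∀ i, MeasurableSpace (E i)] (μ : ∀ i, Measure (E i)) [∀ i, IsProbabilityMeasure (μ i)]
    (f : ∀ i, E i → ENNReal) (hf : ∀ i, Measurable (f i)) :
    ∫⁻ x, ∏ i, f i (x i) ∂Measure.pi μ = ∏ i, ∫⁻ x, f i x ∂μ i := by
  refine (lintegral_prod_eq_prod_lintegral_of_indepFun Finset.univ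
    (fun i (x : ∀ i, E i) => f i (x i)) (iIndepFun_pi fun i => (hf i).aemeasurable)
    fun i => (hf i).comp (measurable_pi_apply i)).trans ?_
  exact Finset.prod_congr rfl fun i _ => (measurePreserving_eval μ i).lintegral_comp (hf i)

theorem IsDensityShift.pi {ι : Type*} [Fintype ι] {E : ι → Type*}
    [∀ i, MeasurableSpace (E i)] {μ : ∀ i, Measure (E i)} [∀ i, IsProbabilityMeasure (μ i)]
    {T : ∀ i, E i → E i} {g : ∀ i, E i → ℝ} (h : ∀ i, IsDensityShift (μ i) (T i) (g i)) :
    IsDensityShift (Measure.pi μ) (fun x i => T i (x i)) (fun x => ∏ i, g i (x i)) := by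
  have hT : Measurable fun (x : ∀ i, E i) i => T i (x i) :=
    measurable_pi_lambda _ fun i => (h i).1.comp (measurable_pi_apply i)
  refine ⟨hT, Finset.measurable_prod _ fun i _ => (h i).2.1.comp (measurable_pi_apply i),
    fun x => Finset.prod_nonneg fun i _ => (h i).2.2.1 _, Eq.symm (Measure.pi_eq fun s hs => ?_)⟩
  have hpre : (fun (x : ∀ i, E i) i => T i (x i)) ⁻¹' Set.univ.pi s =
      Set.univ.pi fun i => T i ⁻¹' s i := by
    ext x; simp
  have hms : ∀ i, MeasurableSet (T i ⁻¹' s i) := fun i => (h i).1 (hs i)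
  rw [Measure.map_apply hT (MeasurableSet.univ_pi hs), hpre,
    withDensity_apply _ (MeasurableSet.univ_pi hms),
    ← lintegral_indicator (MeasurableSet.univ_pi hms)]
  have hind : (Set.univ.pi fun i => T i ⁻¹' s i).indicator
      (fun x : ∀ i, E i => ENNReal.ofReal (∏ i, g i (x i))) =
      fun x => ∏ i, (T i ⁻¹' s i).indicator (fun y => ENNReal.ofReal (g i y)) (x i) := by
    ext x
    by_cases hx : x ∈ Set.univ.pi fun i => T i ⁻¹' s i
    · rw [Set.indicator_of_mem hx, ENNReal.ofReal_prod_of_nonneg fun i _ => (h i).2.2.1 _]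
      refine Finset.prod_congr rfl fun i _ => ?_
      rw [Set.indicator_of_mem (hx i trivial)]
    · rw [Set.indicator_of_notMem hx]
      simp only [Set.mem_univ_pi, not_forall] at hx
      obtain ⟨i, hi⟩ := hx
      exact (Finset.prod_eq_zero (Finset.mem_univ i) (Set.indicator_of_notMem hi _)).symm
  rw [hind, lintegral_fintype_prod_eq_prod _ _ fun i =>
    ((h i).2.1.ennreal_ofReal).indicator (hms i)]
  refine Finset.prod_congr rfl fun i _ => ?_
  rw [lintegral_indicator (hms i), ← withDensity_apply _ (hms i), ← Measure.map_apply (h i).1 (hs i),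
    (h i).2.2.2]

theorem IsDensityShift.integral_eq {E : Type*} [MeasurableSpace E] {μ : Measure E} {T : E → E}
    {g : E → ℝ} (h : IsDensityShift μ T g) {f : E → ℝ} (hf : Measurable f) :
    ∫ x, g x * f (T x) ∂μ = ∫ x, f x ∂μ := by
  conv_rhs => rw [← h.2.2.2]
  rw [integral_map h.1.aemeasurable hf.aestronglyMeasurable,
    integral_withDensity_eq_integral_toReal_smul h.2.1.ennreal_ofReal (by simp)]
  simp [ENNReal.toReal_ofReal (h.2.2.1 _)]

theorem IsDensityShift.integrable {E : Type*} [MeasurableSpace E] {μ : Measure E} {T : E → E}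
    {g : E → ℝ} (h : IsDensityShift μ T g) {f : E → ℝ} (hf : Integrable f μ) :
    Integrable (fun x => g x * f (T x)) μ := by
  rw [← h.2.2.2] at hf
  have := (integrable_map_measure hf.1 h.1.aemeasurable).1 hf
  rw [integrable_withDensity_iff_integrable_smul' h.2.1.ennreal_ofReal (by simp)] at this
  simpa [ENNReal.toReal_ofReal (h.2.2.1 _)] using this

/-- Variance `1 / 2` means a density proportional to `exp (-x ^ 2)`, and `(x + d) ^ 2 = x ^ 2 + 2 *
x * d + d ^ 2`. -/
theorem isDensityShift_gaussianReal (d : ℝ) :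
    IsDensityShift (gaussianReal 0 (1 / 2)) (fun x => x + d)
      (fun x => Real.exp (-(2 * x * d) - d ^ 2)) := by
  refine ⟨by fun_prop, by fun_prop, fun x => (Real.exp_pos _).le, ?_⟩
  have h2 : (1 / 2 : NNReal) ≠ 0 := by norm_num
  have h1 : ((gaussianReal 0 (1 / 2)).withDensity
      fun x => ENNReal.ofReal (Real.exp (-(2 * x * d) - d ^ 2))) =
      gaussianReal (-d) (1 / 2) := by
    rw [gaussianReal_of_var_ne_zero _ h2, gaussianReal_of_var_ne_zero _ h2,
      ← withDensity_mul _ (measurable_gaussianPDF _ _) (by fun_prop)]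
    congr 1
    ext x
    simp only [Pi.mul_apply, gaussianPDF]
    rw [← ENNReal.ofReal_mul (gaussianPDFReal_nonneg _ _ _)]
    congr 1
    simp only [gaussianPDFReal]
    rw [mul_assoc, ← Real.exp_add]
    congr 2
    push_cast
    ring
  rw [h1, gaussianReal_map_add_const]
  simp

theorem IsDensityShift.prod {E F : Type*} [MeasurableSpace E] [MeasurableSpace F]
    {μ : Measure E} {ν : Measure F} [IsProbabilityMeasure μ] [IsProbabilityMeasure ν]
    {T : E → E} {S : F → F} {g : E → ℝ} {f : F → ℝ} (hμ : IsDensityShift μ T g)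
    (hν : IsDensityShift ν S f) :
    IsDensityShift (μ.prod ν) (fun p => (T p.1, S p.2)) (fun p => g p.1 * f p.2) := by
  obtain ⟨hT, hg, hg0, hμT⟩ := hμ
  obtain ⟨hS, hf, hf0, hνS⟩ := hν
  have hTS : Measurable fun p : E × F => (T p.1, S p.2) := by fun_prop
  refine ⟨hTS, by fun_prop, fun p => mul_nonneg (hg0 _) (hf0 _),
    Eq.symm (Measure.prod_eq fun s t hs ht => ?_)⟩
  have hpre : (fun p : E × F => (T p.1, S p.2)) ⁻¹' (s ×ˢ t) = (T ⁻¹' s) ×ˢ (S ⁻¹' t) := by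
    ext p; simp
  rw [Measure.map_apply hTS (hs.prod ht), hpre, withDensity_apply _ ((hT hs).prod (hS ht)),
    ← Measure.prod_restrict]
  simp_rw [ENNReal.ofReal_mul (hg0 _)]
  rw [lintegral_prod_mul hg.ennreal_ofReal.aemeasurable hf.ennreal_ofReal.aemeasurable,
    ← withDensity_apply _ (hT hs), ← withDensity_apply _ (hS ht), ← Measure.map_apply hT hs,
    ← Measure.map_apply hS ht, hμT, hνS]

theorem IsDensityShift.map {E F : Type*} [MeasurableSpace E] [MeasurableSpace F]
    {μ : Measure E} {T : E → E} {S : F → F} {g : E → ℝ} {f : F → ℝ} {e : E → F}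
    (he : Measurable e) (hS : Measurable S) (hf : Measurable f) (hf0 : ∀ x, 0 ≤ f x)
    (hμ : IsDensityShift μ T g) (hTS : ∀ x, S (e x) = e (T x)) (hgf : ∀ x, f (e x) = g x) :
    IsDensityShift (μ.map e) S f := by
  obtain ⟨hT, hg, hg0, hμT⟩ := hμ
  refine ⟨hS, hf, hf0, ?_⟩
  have h1 : (μ.map e).withDensity (fun x => ENNReal.ofReal (f x)) =
      (μ.withDensity fun x => ENNReal.ofReal (g x)).map e := by
    ext s hs
    rw [withDensity_apply _ hs, Measure.map_apply he hs, withDensity_apply _ (he hs),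
      setLIntegral_map hs hf.ennreal_ofReal he]
    simp_rw [hgf]
  rw [h1, Measure.map_map hS he, show S ∘ e = e ∘ T from funext hTS, ← Measure.map_map he hT, hμT]

theorem isDensityShift_complexGaussian (d : ℂ) :
    IsDensityShift complexGaussian (fun w => w + d)
      (fun w => Real.exp (-(2 * (w * (starRingEnd ℂ) d).re) - ‖d‖ ^ 2)) := by
  refine IsDensityShift.map (by fun_prop) (by fun_prop) (by fun_prop)
    (fun x => (Real.exp_pos _).le)
    ((isDensityShift_gaussianReal d.re).prod (isDensityShift_gaussianReal d.im)) ?_ ?_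
  · rintro ⟨x, y⟩
    apply Complex.ext <;> simp [Complex.measurableEquivRealProd_symm_apply]
  · rintro ⟨x, y⟩
    rw [← Real.exp_add, Complex.sq_norm, Complex.normSq_apply]
    simp only [Complex.measurableEquivRealProd_symm_apply, Complex.mul_re, Complex.conj_re,
      Complex.conj_im]
    ring_nf

theorem integral_re_mul_complexGaussian (d : ℂ) :
    Integrable (fun w : ℂ => (w * d).re) complexGaussian ∧
      ∫ w : ℂ, (w * d).re ∂complexGaussian = 0 := by
  have hint : Integrable (fun w : ℂ => (w * d).re) complexGaussian :=
    (integrable_id_complexGaussian.mul_const d).re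
  refine ⟨hint, ?_⟩
  rw [integrable_complexGaussian_iff (by fun_prop)] at hint
  rw [integral_complexGaussian (by fun_prop), integral_prod _ hint]
  have h1 : ∀ x : ℝ, ∫ y : ℝ, ((⟨x, y⟩ : ℂ) * d).re ∂gaussianReal 0 (1 / 2) = x * d.re := by
    intro x
    have hy : Integrable (fun y : ℝ => y * d.im) (gaussianReal 0 (1 / 2)) :=
      (memLp_one_iff_integrable.1 (memLp_id_gaussianReal 1)).mul_const _
    simp only [Complex.mul_re]
    rw [integral_sub (integrable_const _) hy, integral_mul_const, integral_mul_const,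
      integral_id_gaussianReal]
    simp
  simp_rw [h1]
  rw [integral_mul_const, integral_id_gaussianReal, zero_mul]

end Noise

/-! ### Codes, decoders and delivery in slots. -/

section SlotSchemes

/-- Codes for `m` channel uses with squared minimum distance `D * m`, on a grid of amplitude
`2 ^ s`, that carry `2 * s - O(1)` bits per channel use. -/
theorem exists_code (D : ℝ) (hD : 0 ≤ D) : ∃ c : ℕ, ∀ s : ℕ, c ≤ 2 * s → ∀ m : ℕ,
    ∃ φ : (Fin (m * (2 * s - c)) → ZMod 2) → Fin m → ℂ,
      (∀ u i, ‖φ u i‖ ≤ 2 * 2 ^ s) ∧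
      ∀ u u', ∑ i, ‖φ u i - φ u' i‖ ^ 2 ≤ D * m → u = u' := by
  -- `16` bounds the sum of `exp (-distance ^ 2)` over the grid in one channel use, so `2 ^ (c * m)`
  -- will bound the balls of squared radius `D * m`.
  obtain ⟨c, hc⟩ := pow_unbounded_of_one_lt (Real.exp D * 16) (one_lt_two : (1 : ℝ) < 2)
  refine ⟨c, fun s hs m => ?_⟩
  set q := 2 ^ s with hq
  let emb : Fin q × Fin q → ℂ := fun p => ⟨p.1, p.2⟩
  have hembnorm : ∀ p p', ‖emb p - emb p'‖ ^ 2 =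
      ((p.1 : ℝ) - p'.1) ^ 2 + ((p.2 : ℝ) - p'.2) ^ 2 := by
    intro p p'
    rw [Complex.sq_norm, Complex.normSq_apply]
    simp only [emb, Complex.sub_re, Complex.sub_im]
    ring
  have hone : ∀ a : Fin q, ∑ b : Fin q, Real.exp (-((a : ℝ) - b) ^ 2) ≤ 4 := by
    intro a
    have h1 := sum_exp_neg_abs_le 1 one_pos
      (Finset.univ.image fun b : Fin q => ((a : ℕ) : ℤ) - ((b : ℕ) : ℤ))
    rw [Finset.sum_image (by
      intro b _ b' _ h
      apply Fin.ext
      simp only at h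
      omega)] at h1
    refine le_trans (Finset.sum_le_sum fun b _ => ?_) (h1.trans (by norm_num))
    apply Real.exp_le_exp.2
    rw [one_mul, neg_le_neg_iff]
    set z : ℤ := ((a : ℕ) : ℤ) - ((b : ℕ) : ℤ) with hz
    have h2 : ((a : ℝ) - b) = (z : ℝ) := by rw [hz]; push_cast; rfl
    rw [h2]
    have h3 : |z| ≤ z ^ 2 := by
      rw [← sq_abs]
      nlinarith [abs_nonneg z, Int.le_self_sq |z|]
    exact_mod_cast h3
  have hpair : ∀ p : Fin q × Fin q, ∑ p', Real.exp (-‖emb p - emb p'‖ ^ 2) ≤ 16 := by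
    intro p
    simp_rw [hembnorm, neg_add, Real.exp_add]
    rw [Fintype.sum_prod_type]
    simp_rw [← Finset.mul_sum]
    rw [← Finset.sum_mul]
    have h1 := hone p.1
    have h2 := hone p.2
    have h3 : 0 ≤ ∑ b : Fin q, Real.exp (-((p.2 : ℝ) - b) ^ 2) :=
      Finset.sum_nonneg fun _ _ => (Real.exp_pos _).le
    nlinarith
  let near : (Fin m → Fin q × Fin q) → (Fin m → Fin q × Fin q) → Prop := fun x y =>
    x = y ∨ ∑ i, ‖emb (x i) - emb (y i)‖ ^ 2 ≤ D * m
  have hball : ∀ x, {y | near x y}.ncard ≤ 2 ^ (c * m) := by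
    classical
    intro x
    -- Each point of the ball has weight `exp (D * m - distance ^ 2) ≥ 1`; the sum of the weights
    -- over all words factors over the channel uses.
    have hcount : ({y | near x y}.ncard : ℝ) ≤
        ∑ y : Fin m → Fin q × Fin q, Real.exp (D * m) * ∏ i, Real.exp (-‖emb (x i) - emb (y i)‖ ^ 2) := by
      rw [Set.ncard_eq_toFinset_card', ← nsmul_one, ← Finset.sum_const]
      refine le_trans (Finset.sum_le_sum fun (y : Fin m → Fin q × Fin q) hy => ?_)
        (Finset.sum_le_sum_of_subset_of_nonneg (Finset.subset_univ _) fun y _ _ =>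
          mul_nonneg (Real.exp_pos _).le (Finset.prod_nonneg fun _ _ => (Real.exp_pos _).le))
      rw [← Real.exp_sum, ← Real.exp_add]
      apply Real.one_le_exp
      rw [Finset.sum_neg_distrib]
      have hy' : near x y := by simpa using hy
      rcases hy' with rfl | hy'
      · simp; positivity
      · linarith
    have hprod : ∑ y : Fin m → Fin q × Fin q, ∏ i, Real.exp (-‖emb (x i) - emb (y i)‖ ^ 2) ≤
        16 ^ m := by
      rw [← Fintype.piFinset_univ, ← Finset.prod_univ_sum (fun _ => Finset.univ)
        (fun i p => Real.exp (-‖emb (x i) - emb p‖ ^ 2))]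
      calc _ ≤ ∏ _i : Fin m, (16 : ℝ) := Finset.prod_le_prod
            (fun i _ => Finset.sum_nonneg fun _ _ => (Real.exp_pos _).le) fun i _ => hpair (x i)
        _ = 16 ^ m := by simp
    rw [← Finset.mul_sum] at hcount
    have : ({y | near x y}.ncard : ℝ) ≤ (2 ^ c) ^ m := by
      refine hcount.trans ((mul_le_mul_of_nonneg_left hprod (Real.exp_pos _).le).trans ?_)
      rw [mul_comm D, Real.exp_nat_mul, ← mul_pow]
      exact pow_le_pow_left₀ (by positivity) hc.le m
    rw [pow_mul]
    exact_mod_cast this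
  have hq0 : 0 < q := by positivity
  have : NeZero q := ⟨hq0.ne'⟩
  obtain ⟨f, hf⟩ := exists_packing near (fun x => Or.inl rfl)
    (by
      rintro x y (rfl | h)
      · exact Or.inl rfl
      · right
        simp_rw [norm_sub_rev (emb (y _))]
        exact h) _ hball (2 ^ (m * (2 * s - c))) (by
      rw [← pow_add]
      simp only [Fintype.card_pi, Fintype.card_prod, Fintype.card_fin, Finset.prod_const,
        Finset.card_univ, hq]
      rw [← pow_add, ← pow_mul]
      apply le_of_eq
      congr 1
      obtain ⟨r, hr⟩ := Nat.exists_eq_add_of_le hs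
      rw [hr, show s + s = c + r by omega]
      simp only [Nat.add_sub_cancel_left]
      ring)
  let e : (Fin (m * (2 * s - c)) → ZMod 2) ≃ Fin (2 ^ (m * (2 * s - c))) :=
    Fintype.equivFinOfCardEq (by simp [ZMod.card])
  refine ⟨fun u i => emb (f (e u) i), fun u i => ?_, fun u u' h => ?_⟩
  · refine (Complex.norm_le_abs_re_add_abs_im _).trans ?_
    have h1 : (((f (e u) i).1 : ℕ) : ℝ) ≤ 2 ^ s := by exact_mod_cast (f (e u) i).1.2.le
    have h2 : (((f (e u) i).2 : ℕ) : ℝ) ≤ 2 ^ s := by exact_mod_cast (f (e u) i).2.2.le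
    simp only [emb, Nat.abs_cast]
    linarith
  · exact e.injective (hf _ _ (Or.inr h))

/-- A cache content and an encoder for which the requested files are determined by the cache and
the received symbols, whenever the noise is in `G`, have decoders that err only outside `G`. -/
theorem exists_scheme_of_separated {L K₁ K₂ N F n : ℕ} (H : Channel L K₁ K₂)
    (cache : User K₁ K₂ → Finset (Fin N × Fin F))
    (encode : (User K₁ K₂ → Fin N) → Library N F → Fin n → Fin L → ℂ)
    (G : Set (Fin n → ℂ)) (hG : MeasurableSet G)
    (hsep : ∀ d : User K₁ K₂ → Fin N, Function.Injective d → ∀ k W W',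
      (∀ p ∈ cache k, W p.1 p.2 = W' p.1 p.2) → ∀ w ∈ G, ∀ w' ∈ G,
      (∀ i, (∑ l, (starRingEnd ℂ) (H k l) * encode d W i l) + w i =
        (∑ l, (starRingEnd ℂ) (H k l) * encode d W' i l) + w' i) → W (d k) = W' (d k)) :
    ∃ s : Scheme L K₁ K₂ N F n, s.cache = cache ∧ s.encode = encode ∧
      ∀ d : User K₁ K₂ → Fin N, Function.Injective d → ∀ k,
        s.errorProb H d k ≤ (Measure.pi fun _ : Fin n => complexGaussian).real Gᶜ := by
  classical
  -- A bit is declared `true` when some library that fits the cache and leaves a residual in `G` has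
  -- it `true`. This avoids choosing a candidate and makes each output bit's preimage a finite union
  -- of translates of `G`.
  let dec : (User K₁ K₂ → Fin N) → (k : User K₁ K₂) → (cache k → Bool) → (Fin n → ℂ) →
      Fin F → Bool := fun d k c y f => decide (∃ W' : Library N F,
        ((∀ p : cache k, W' p.1.1 p.1.2 = c p) ∧ W' (d k) f = true) ∧
        (fun i => y i - ∑ l, (starRingEnd ℂ) (H k l) * encode d W' i l) ∈ G)
  have hdec : ∀ d k c, Measurable (dec d k c) := by
    intro d k c
    refine measurable_pi_lambda _ fun f => measurable_to_bool ?_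
    have : (fun y => dec d k c y f) ⁻¹' {true} = ⋃ W' ∈ {W' : Library N F |
        (∀ p : cache k, W' p.1.1 p.1.2 = c p) ∧ W' (d k) f = true},
        (fun (y : Fin n → ℂ) i => y i - ∑ l, (starRingEnd ℂ) (H k l) * encode d W' i l) ⁻¹' G := by
      ext y
      simp [dec]
    rw [this]
    refine MeasurableSet.biUnion (Set.to_countable _) fun W' _ => ?_
    exact (by fun_prop : Measurable fun (y : Fin n → ℂ) i =>
      y i - ∑ l, (starRingEnd ℂ) (H k l) * encode d W' i l) hG
  refine ⟨⟨cache, encode, dec, hdec⟩, rfl, rfl, fun d hd k => ?_⟩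
  unfold Scheme.errorProb
  rw [div_le_iff₀ (by exact_mod_cast Fintype.card_pos), mul_comm, ← nsmul_eq_mul,
    ← Finset.card_univ, ← Finset.sum_const]
  refine Finset.sum_le_sum fun W _ => measureReal_mono fun w hw hwG => hw ?_
  ext f
  have hmem : ∀ W' : Library N F, (∀ p : cache k, W' p.1.1 p.1.2 = W p.1.1 p.1.2) →
      (fun i => ((∑ l, (starRingEnd ℂ) (H k l) * encode d W i l) + w i) -
        ∑ l, (starRingEnd ℂ) (H k l) * encode d W' i l) ∈ G → W (d k) = W' (d k) := by
    intro W' hc hW'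
    refine hsep d hd k W W' (fun p hp => (hc ⟨p, hp⟩).symm) w hwG _ hW' fun i => ?_
    ring
  simp only [Scheme.output, Scheme.received, dec]
  by_cases hf : W (d k) f = true
  · rw [hf, decide_eq_true_iff]
    refine ⟨W, ⟨fun _ => rfl, hf⟩, ?_⟩
    simpa using hwG
  · rw [Bool.eq_false_of_not_eq_true hf, decide_eq_false_iff_not]
    rintro ⟨W', ⟨hc, hf'⟩, hW'⟩
    rw [← hmem W' hc hW'] at hf'
    exact hf hf'

theorem exists_pos_lower_bound {α : Type*} [Finite α] (f : α → ℝ) :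
    ∃ c : ℝ, 0 < c ∧ ∀ a, 0 < f a → c ≤ f a := by
  classical
  cases nonempty_fintype α
  by_cases h : (Finset.univ.filter fun a => 0 < f a).Nonempty
  · obtain ⟨a, ha, hmin⟩ := Finset.exists_min_image _ f h
    exact ⟨f a, (Finset.mem_filter.1 ha).2, fun b hb =>
      hmin b (Finset.mem_filter.2 ⟨Finset.mem_univ _, hb⟩)⟩
  · refine ⟨1, one_pos, fun a ha => absurd ⟨a, Finset.mem_filter.2 ⟨Finset.mem_univ _, ha⟩⟩ h⟩

/-- Delivery in slots: every file is split into pieces, user `k` stores the pieces `Z k` of all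
files, and in slot `s` the sums (over `ZMod 2`) of the pieces `M d s st` are sent in parallel streams
`st` along the beams `v d s st`. All streams use the code `φ`. -/
theorem exists_slot_scheme {L K₁ K₂ N : ℕ} {Slot Piece Stream : Type*} [Fintype Slot]
    [Fintype Piece] [Fintype Stream] [Nonempty Slot] [Nonempty Piece] [DecidableEq Piece]
    (H : Channel L K₁ K₂) (γ₁ γ₂ : ℝ) (Z : User K₁ K₂ → Finset Piece)
    (hZ₁ : ∀ i, ((Z (Sum.inl i)).card : ℝ) ≤ γ₁ * Fintype.card Piece)
    (hZ₂ : ∀ j, ((Z (Sum.inr j)).card : ℝ) ≤ γ₂ * Fintype.card Piece)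
    (M : (User K₁ K₂ → Fin N) → Slot → Stream → Finset (Fin N × Piece))
    (v : (User K₁ K₂ → Fin N) → Slot → Stream → Fin L → ℂ)
    (hdel : ∀ d : User K₁ K₂ → Fin N, Function.Injective d → ∀ k, ∀ p ∉ Z k, ∃ s st,
      (d k, p) ∈ M d s st ∧ (∀ q ∈ M d s st, q ≠ (d k, p) → q.2 ∈ Z k) ∧
      ∑ l, (starRingEnd ℂ) (H k l) * v d s st l ≠ 0 ∧
      ∀ st', st' ≠ st → ∑ l, (starRingEnd ℂ) (H k l) * v d s st' l = 0 ∨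
        ∀ q ∈ M d s st', q.2 ∈ Z k)
    {C c₀ V a : ℝ} (hc₀ : 0 < c₀) (ha : 0 ≤ a)
    (hc₀' : ∀ k d s st, ∑ l, (starRingEnd ℂ) (H k l) * v d s st l ≠ 0 →
      c₀ ≤ ‖∑ l, (starRingEnd ℂ) (H k l) * v d s st l‖)
    (hV : ∀ d s st l, ‖v d s st l‖ ≤ V) (m b : ℕ)
    (φ : (Fin b → ZMod 2) → Fin m → ℂ) (hφ : ∀ u i, ‖φ u i‖ ≤ a)
    (hφ' : ∀ u u', ∑ i, ‖φ u i - φ u' i‖ ^ 2 ≤ 4 * Fintype.card Slot * C / c₀ ^ 2 * m → u = u') :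
    ∃ s : Scheme L K₁ K₂ N (Fintype.card Piece * b) (Fintype.card Slot * m),
      s.CacheConstraint γ₁ γ₂ ∧
      s.PowerConstraint (L * (Fintype.card Stream * (a * V)) ^ 2) ∧
      ∀ d : User K₁ K₂ → Fin N, Function.Injective d → ∀ k, s.errorProb H d k ≤
        (Measure.pi fun _ : Fin (Fintype.card Slot * m) => complexGaussian).real
          {w | ((Fintype.card Slot * m : ℕ) : ℝ) * C < ∑ i, ‖w i‖ ^ 2} := by
  classical
  set S := Fintype.card Slot with hS
  set Q := Fintype.card Piece with hQ
  let ip : User K₁ K₂ → (Fin L → ℂ) → ℂ := fun k x => ∑ l, (starRingEnd ℂ) (H k l) * x l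
  let eP : Fin (Q * b) ≃ Piece × Fin b := Fintype.equivOfCardEq (by simp [hQ])
  let eS : Fin (S * m) ≃ Slot × Fin m := Fintype.equivOfCardEq (by simp [hS])
  let bit : Library N (Q * b) → Fin N × Piece → Fin b → ZMod 2 := fun W q r =>
    if W q.1 (eP.symm (q.2, r)) then 1 else 0
  let msg : (User K₁ K₂ → Fin N) → Library N (Q * b) → Slot → Stream → Fin b → ZMod 2 :=
    fun d W s st => ∑ q ∈ M d s st, bit W q
  let cache : User K₁ K₂ → Finset (Fin N × Fin (Q * b)) := fun k =>
    Finset.univ ×ˢ Finset.univ.filter fun f => (eP f).1 ∈ Z k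
  let encode : (User K₁ K₂ → Fin N) → Library N (Q * b) → Fin (S * m) → Fin L → ℂ :=
    fun d W i l => ∑ st, φ (msg d W (eS i).1 st) (eS i).2 * v d (eS i).1 st l
  let G : Set (Fin (S * m) → ℂ) := {w | ∑ i, ‖w i‖ ^ 2 ≤ (S * m : ℕ) * C}
  have hG : MeasurableSet G := measurableSet_le (by fun_prop) (by fun_prop)
  have hip : ∀ k d W i, ∑ l, (starRingEnd ℂ) (H k l) * encode d W i l =
      ∑ st, ip k (v d (eS i).1 st) * φ (msg d W (eS i).1 st) (eS i).2 := by
    intro k d W i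
    simp only [encode, ip, Finset.mul_sum, Finset.sum_mul]
    rw [Finset.sum_comm]
    refine Finset.sum_congr rfl fun _ _ => Finset.sum_congr rfl fun _ _ => by ring
  have hsep : ∀ d : User K₁ K₂ → Fin N, Function.Injective d → ∀ k W W',
      (∀ p ∈ cache k, W p.1 p.2 = W' p.1 p.2) → ∀ w ∈ G, ∀ w' ∈ G,
      (∀ i, (∑ l, (starRingEnd ℂ) (H k l) * encode d W i l) + w i =
        (∑ l, (starRingEnd ℂ) (H k l) * encode d W' i l) + w' i) → W (d k) = W' (d k) := by
    intro d hd k W W' hWW w hw w' hw' hy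
    have hcached : ∀ q : Fin N × Piece, q.2 ∈ Z k → bit W q = bit W' q := by
      intro q hq
      ext r
      simp only [bit]
      rw [hWW (q.1, eP.symm (q.2, r)) (by simpa [cache] using hq)]
    have hpiece : ∀ p, bit W (d k, p) = bit W' (d k, p) := by
      intro p
      by_cases hp : p ∈ Z k
      · exact hcached _ hp
      obtain ⟨s, st, hmem, hoth, hne, hint⟩ := hdel d hd k p hp
      have hmsg : msg d W s st = msg d W' s st := by
        apply hφ'
        have hdiff : ∀ r, ip k (v d s st) * (φ (msg d W s st) r - φ (msg d W' s st) r) =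
            w' (eS.symm (s, r)) - w (eS.symm (s, r)) := by
          intro r
          have h1 := hy (eS.symm (s, r))
          rw [hip, hip] at h1
          simp only [Equiv.apply_symm_apply] at h1
          -- Two libraries that look alike to user `k` differ only in the desired stream: every
          -- other stream is either nulled at `k` or made of cached pieces.
          have h2 : ∑ st', (ip k (v d s st') * φ (msg d W s st') r -
              ip k (v d s st') * φ (msg d W' s st') r) =
              ip k (v d s st) * (φ (msg d W s st) r - φ (msg d W' s st) r) := by
            rw [Finset.sum_eq_single st]
            · ring
            · intro st' _ hst'
              rcases hint st' hst' with h | h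
              · rw [show ip k (v d s st') = 0 from h]; ring
              · have : msg d W s st' = msg d W' s st' :=
                  Finset.sum_congr rfl fun q hq => hcached q (h q hq)
                rw [this, sub_self]
            · simp
          rw [Finset.sum_sub_distrib] at h2
          rw [← h2]
          linear_combination h1
        have hc₀k : c₀ ≤ ‖ip k (v d s st)‖ := hc₀' k d s st hne
        have hterm : ∀ r, c₀ ^ 2 * ‖φ (msg d W s st) r - φ (msg d W' s st) r‖ ^ 2 ≤
            2 * (‖w (eS.symm (s, r))‖ ^ 2 + ‖w' (eS.symm (s, r))‖ ^ 2) := by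
          intro r
          have h1 : ‖w' (eS.symm (s, r)) - w (eS.symm (s, r))‖ ≤
            ‖w' (eS.symm (s, r))‖ + ‖w (eS.symm (s, r))‖ := norm_sub_le _ _
          rw [← hdiff r, norm_mul] at h1
          have h2 := mul_le_mul_of_nonneg_right hc₀k
            (norm_nonneg (φ (msg d W s st) r - φ (msg d W' s st) r))
          have h3 := pow_le_pow_left₀ (by positivity) (h2.trans h1) 2
          rw [mul_pow] at h3
          nlinarith [sq_nonneg (‖w' (eS.symm (s, r))‖ - ‖w (eS.symm (s, r))‖)]
        -- One slot may absorb the noise budget of the whole transmission. With the factor `2` of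
        -- `hterm` and two noise vectors, this accounts for the `4 * card Slot` in the required
        -- distance.
        have hblock : ∀ w ∈ G, ∑ r, ‖w (eS.symm (s, r))‖ ^ 2 ≤ (S * m : ℕ) * C := by
          intro w hw
          refine le_trans ?_ hw
          rw [← eS.symm.sum_comp, Fintype.sum_prod_type]
          exact Finset.single_le_sum (f := fun s => ∑ r, ‖w (eS.symm (s, r))‖ ^ 2)
            (fun _ _ => by positivity) (Finset.mem_univ s)
        have hsum := Finset.sum_le_sum fun r (_ : r ∈ Finset.univ) => hterm r
        rw [← Finset.mul_sum, ← Finset.mul_sum, Finset.sum_add_distrib] at hsum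
        have h1 := hblock w hw
        have h2 := hblock w' hw'
        rw [div_mul_eq_mul_div, le_div_iff₀ (by positivity)]
        push_cast at h1 h2
        linarith
      simp only [msg] at hmsg
      rw [← Finset.add_sum_erase _ _ hmem, ← Finset.add_sum_erase _ _ hmem,
        Finset.sum_congr rfl fun q hq => hcached q
          (hoth q (Finset.mem_of_mem_erase hq) (Finset.ne_of_mem_erase hq))] at hmsg
      exact add_right_cancel hmsg
    ext f
    have h1 := congrFun (hpiece (eP f).1) (eP f).2
    simp only [bit, Prod.mk.eta, Equiv.symm_apply_apply] at h1
    by_cases h2 : W (d k) f = true <;> by_cases h3 : W' (d k) f = true <;>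
      simp [h2, h3] at h1 ⊢
  obtain ⟨sch, hsc, hse, herr⟩ := exists_scheme_of_separated H cache encode G hG hsep
  have hcard : ∀ k, ((sch.cache k).card : ℝ) = N * ((Z k).card * b) := by
    intro k
    rw [hsc]
    have : (Finset.univ.filter fun f => (eP f).1 ∈ Z k).card = (Z k).card * b := by
      have h1 : (Z k ×ˢ (Finset.univ : Finset (Fin b))).card = (Z k).card * b := by
        rw [Finset.card_product, Finset.card_fin]
      rw [← h1]
      refine Finset.card_bij (fun f _ => eP f) (fun f hf => ?_)
        (fun f _ f' _ h => eP.injective h) fun x hx => ⟨eP.symm x, ?_, by simp⟩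
      · simpa using hf
      · simpa using hx
    simp only [cache, Finset.card_product, this]
    simp
  refine ⟨sch, ⟨fun i => ?_, fun j => ?_⟩, fun d hd => ?_, fun d hd k =>
    (herr d hd k).trans (le_of_eq ?_)⟩
  · rw [hcard]
    have := mul_le_mul_of_nonneg_right (hZ₁ i) (by positivity : (0 : ℝ) ≤ N * b)
    push_cast
    linarith
  · rw [hcard]
    have := mul_le_mul_of_nonneg_right (hZ₂ j) (by positivity : (0 : ℝ) ≤ N * b)
    push_cast
    linarith
  · rw [hse, div_le_iff₀ (by exact_mod_cast Fintype.card_pos)]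
    have hpt : ∀ W i, ∑ l, ‖encode d W i l‖ ^ 2 ≤ L * (Fintype.card Stream * (a * V)) ^ 2 := by
      intro W i
      have h1 : ∀ l, ‖encode d W i l‖ ^ 2 ≤ (Fintype.card Stream * (a * V)) ^ 2 := by
        intro l
        refine pow_le_pow_left₀ (norm_nonneg _) ?_ 2
        rw [← nsmul_eq_mul, ← Finset.card_univ, ← Finset.sum_const]
        refine (norm_sum_le _ _).trans (Finset.sum_le_sum fun st _ => ?_)
        rw [norm_mul]
        exact mul_le_mul (hφ _ _) (hV _ _ _ _) (norm_nonneg _) ha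
      refine (Finset.sum_le_sum fun l _ => h1 l).trans (le_of_eq ?_)
      rw [Finset.sum_const, Finset.card_univ, Fintype.card_fin, nsmul_eq_mul]
    calc ∑ W, ∑ i, ∑ l, ‖encode d W i l‖ ^ 2
        ≤ ∑ _W : Library N (Q * b), ∑ _i : Fin (S * m),
            (L * (Fintype.card Stream * (a * V)) ^ 2 : ℝ) :=
          Finset.sum_le_sum fun W _ => Finset.sum_le_sum fun i _ => hpt W i
      _ = _ := by
          simp only [Finset.sum_const, Finset.card_univ, nsmul_eq_mul, Fintype.card_fin]
          ring
  · congr 1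
    ext w
    simp [G]

/-- The delay achieved by delivery in slots (see `exists_slot_scheme`). -/
theorem isAchievableDelay_of_slots {L K₁ K₂ N : ℕ} {Slot Piece Stream : Type*} [Fintype Slot]
    [Fintype Piece] [Fintype Stream] [Nonempty Slot] [Nonempty Piece] [DecidableEq Piece]
    (H : Channel L K₁ K₂) (γ₁ γ₂ : ℝ) (Z : User K₁ K₂ → Finset Piece)
    (hZ₁ : ∀ i, ((Z (Sum.inl i)).card : ℝ) ≤ γ₁ * Fintype.card Piece)
    (hZ₂ : ∀ j, ((Z (Sum.inr j)).card : ℝ) ≤ γ₂ * Fintype.card Piece)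
    (M : (User K₁ K₂ → Fin N) → Slot → Stream → Finset (Fin N × Piece))
    (v : (User K₁ K₂ → Fin N) → Slot → Stream → Fin L → ℂ)
    (hdel : ∀ d : User K₁ K₂ → Fin N, Function.Injective d → ∀ k, ∀ p ∉ Z k, ∃ s st,
      (d k, p) ∈ M d s st ∧ (∀ q ∈ M d s st, q ≠ (d k, p) → q.2 ∈ Z k) ∧
      ∑ l, (starRingEnd ℂ) (H k l) * v d s st l ≠ 0 ∧
      ∀ st', st' ≠ st → ∑ l, (starRingEnd ℂ) (H k l) * v d s st' l = 0 ∨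
        ∀ q ∈ M d s st', q.2 ∈ Z k) :
    IsAchievableDelay N γ₁ γ₂ H (Fintype.card Slot / Fintype.card Piece) := by
  classical
  obtain ⟨C, hC, hnoise⟩ := exists_noise_energy_bound
  let ip : User K₁ K₂ → (Fin L → ℂ) → ℂ := fun k x => ∑ l, (starRingEnd ℂ) (H k l) * x l
  obtain ⟨c₀, hc₀, hc₀'⟩ := exists_pos_lower_bound
    fun a : User K₁ K₂ × (User K₁ K₂ → Fin N) × Slot × Stream => ‖ip a.1 (v a.2.1 a.2.2.1 a.2.2.2)‖
  obtain ⟨V, hV⟩ : ∃ V : ℝ, ∀ d s st l, ‖v d s st l‖ ≤ V := by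
    obtain ⟨V, hV⟩ := (Set.finite_range
      fun a : (User K₁ K₂ → Fin N) × Slot × Stream × Fin L => ‖v a.1 a.2.1 a.2.2.1 a.2.2.2‖).bddAbove
    exact ⟨V, fun d s st l => hV ⟨(d, s, st, l), rfl⟩⟩
  set S := Fintype.card Slot with hS
  set Q := Fintype.card Piece with hQ
  have hS0 : 0 < S := Fintype.card_pos
  have hQ0 : 0 < Q := Fintype.card_pos
  set D := 4 * S * C / c₀ ^ 2 with hD
  have hD0 : 0 ≤ D := by positivity
  obtain ⟨c, hcode⟩ := exists_code D hD0
  -- The power used on the grid of amplitude `2 ^ σ` is less than `A * 4 ^ σ`; the summand `1` only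
  -- keeps `A` positive.
  set A := L * (Fintype.card Stream * (2 * V)) ^ 2 + 1 with hA
  have hA0 : 0 < A := by positivity
  intro δ hδ
  -- Bounds the gap between `log₂ P` and the code rate `β = 2 * σ - c`, since `P ≤ A * 4 ^ (σ + 1)`.
  set c' : ℝ := c + 2 + |Real.logb 2 A| with hc'
  have hc'0 : 0 < c' := by positivity
  set T : ℝ := (S : ℝ) / Q with hT
  have hT0 : 0 ≤ T := by positivity
  -- Large enough that `β > T * c' / δ`, so the rate loss costs at most `δ` in delay.
  obtain ⟨σ₀, hσ₀⟩ := exists_nat_gt (T * c' / δ + c + 1)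
  filter_upwards [eventually_ge_atTop (A * 4 ^ σ₀)] with P hP
  have hP1 : 4 ^ σ₀ ≤ P / A := by rw [le_div_iff₀ hA0]; linarith
  obtain ⟨σ, hσ, hσ'⟩ := exists_nat_pow_near ((one_le_pow₀ (by norm_num : (1 : ℝ) ≤ 4)).trans hP1)
    (by norm_num : (1 : ℝ) < 4)
  have hσσ : σ₀ ≤ σ := by
    have := hP1.trans_lt hσ'
    have := (pow_lt_pow_iff_right₀ (by norm_num : (1 : ℝ) < 4)).1 this
    omega
  have hσr : (σ₀ : ℝ) ≤ σ := by exact_mod_cast hσσ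
  have hTc : 0 ≤ T * c' / δ := by positivity
  have hcσ : (c : ℝ) + 1 < σ := by linarith
  have hcσ' : c + 1 < σ := by exact_mod_cast hcσ
  have hP0 : 0 < P := lt_of_lt_of_le (by positivity) hP
  obtain ⟨β, hβ⟩ : ∃ β, β = 2 * σ - c := ⟨_, rfl⟩
  have hβr : (β : ℝ) = 2 * σ - c := by
    rw [hβ, Nat.cast_sub (by omega)]; push_cast; ring
  have hβ1 : T * c' / δ < β := by rw [hβr]; linarith
  have hβ0 : (0 : ℝ) < β := lt_of_le_of_lt hTc hβ1
  intro η hη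
  obtain ⟨n₀, hn₀⟩ := eventually_atTop.1 (hnoise η hη)
  -- The delay does not depend on the block length `m`, which is free to make the error small at
  -- fixed `P`.
  set m := n₀ + 1 with hm
  have hφex := hcode σ (by omega) m
  obtain ⟨b, hb⟩ : ∃ b, b = m * β := ⟨_, rfl⟩
  rw [← hβ, ← hb] at hφex
  obtain ⟨φ, hφ, hφ'⟩ := hφex
  have hβN : 0 < β := by exact_mod_cast hβ0
  have hb0 : 0 < b := hb ▸ Nat.mul_pos (Nat.succ_pos _) hβN
  obtain ⟨sch, hcache, hpow, herr⟩ := exists_slot_scheme H γ₁ γ₂ Z hZ₁ hZ₂ M v hdel hc₀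
    (by positivity) (fun k d s st h => hc₀' (k, d, s, st) (norm_pos_iff.2 h)) hV m b φ hφ hφ'
  refine ⟨Q * b, S * m, sch, Nat.mul_pos hQ0 hb0, hcache, fun d hd => (hpow d hd).trans ?_,
    fun d hd k => (herr d hd k).trans
      (hn₀ (S * m) ((Nat.le_succ n₀).trans (Nat.le_mul_of_pos_left m hS0))), ?_⟩
  · refine mul_le_mul_of_nonneg_left ?_ (Nat.cast_nonneg _)
    rw [le_div_iff₀ hA0, hA] at hσ
    have h4 : (0 : ℝ) ≤ 4 ^ σ := by positivity
    have h5 : (2 ^ σ : ℝ) ^ 2 = 4 ^ σ := by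
      rw [← pow_mul, mul_comm, pow_mul]; norm_num
    calc (L * (Fintype.card Stream * (2 * 2 ^ σ * V)) ^ 2 : ℝ)
        = 4 ^ σ * (L * (Fintype.card Stream * (2 * V)) ^ 2) := by rw [← h5]; ring
      _ ≤ P := by linarith
  · have hlog : Real.logb 2 P ≤ β + c' := by
      have h1 : P ≤ A * 4 ^ (σ + 1) := by
        rw [div_lt_iff₀ hA0] at hσ'
        linarith
      have h2 := Real.logb_le_logb_of_le (by norm_num : (1 : ℝ) < 2) hP0 h1
      rw [Real.logb_mul hA0.ne' (by positivity), show (4 : ℝ) = 2 ^ 2 by norm_num, ← pow_mul,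
        Real.logb_pow, Real.logb_self_eq_one (by norm_num)] at h2
      push_cast at h2
      rw [hβr, hc']
      have := le_abs_self (Real.logb 2 A)
      linarith
    have hm0 : (0 : ℝ) < m := by rw [hm]; positivity
    have hQ0' : (0 : ℝ) < Q := by exact_mod_cast hQ0
    have h1 : ((S * m : ℕ) : ℝ) * Real.logb 2 P / ((Q * b : ℕ) : ℝ) =
        T * (Real.logb 2 P / β) := by
      rw [hb, hT]
      push_cast
      field_simp
    rw [h1]
    have h2 : T * (Real.logb 2 P / β) ≤ T * ((β + c') / β) :=
      mul_le_mul_of_nonneg_left (div_le_div_of_nonneg_right hlog hβ0.le) hT0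
    refine h2.trans ?_
    rw [div_lt_iff₀ hδ] at hβ1
    rw [add_div, div_self hβ0.ne', mul_add, mul_one, ← mul_div_assoc]
    have : T * c' / β ≤ δ := by
      rw [div_le_iff₀ hβ0]
      linarith
    linarith

end SlotSchemes

/-! ### The joint schedule of coded multicasts and zero-forced private streams. -/

section Schedule

/-- If `K` users have `a` jobs each, and the jobs are assigned cyclically to `g` slots, then at most
`m` users have a job in a given slot, provided `K * a ≤ m * g`. -/
theorem card_jobs_le (K a g m s : ℕ) (hg : 0 < g) (h : K * a ≤ m * g) (S : Finset (Fin K))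
    (hS : ∀ j ∈ S, ∃ i < a, ((j : ℕ) * a + i) % g = s) : S.card ≤ m := by
  choose! i hi his using hS
  rw [← Finset.card_range m]
  -- Number the jobs consecutively. Within one slot the residue mod `g` is fixed, so the quotient
  -- determines the job number and hence the user.
  refine Finset.card_le_card_of_injOn (fun j => ((j : ℕ) * a + i j) / g) (fun j hj => ?_)
    fun j hj j' hj' hjj => ?_
  · simp only [Finset.coe_range, Set.mem_Iio]
    rw [Nat.div_lt_iff_lt_mul hg]
    have h1 := hi j hj
    have h2 : (j : ℕ) + 1 ≤ K := j.2
    have h3 := Nat.mul_le_mul_right a h2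
    rw [add_mul, one_mul] at h3
    omega
  · have h1 := his j hj
    have h2 := his j' hj'
    have h3 := Nat.div_add_mod ((j : ℕ) * a + i j) g
    have h4 := Nat.div_add_mod ((j' : ℕ) * a + i j') g
    simp only at hjj
    rw [hjj, h1] at h3
    rw [h2] at h4
    have h5 : (j : ℕ) * a + i j = j' * a + i j' := h3.symm.trans h4
    have h6 : ((j : ℕ) * a + i j) / a = (j' * a + i j') / a := by rw [h5]
    have ha : 0 < a := (Nat.zero_le _).trans_lt (hi j hj)
    rw [Nat.mul_comm, Nat.mul_comm (j' : ℕ), Nat.mul_add_div ha, Nat.mul_add_div ha,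
      Nat.div_eq_of_lt (hi j hj), Nat.div_eq_of_lt (hi j' hj')] at h6
    exact Fin.ext (by simpa using h6)

/-- For each `χ`, a cache-less user has one job per `κ ∈ χ`: a piece with `τ = χ \ {κ}`. The
bijection `e τ` selects its index from `κ`, so that all `g` pieces with this `τ` are covered as `κ`
runs over the complement of `τ`. The jobs of all cache-less users for `χ` are dealt cyclically to
the `g` slots of `χ`. `hload` then keeps at most `L - 1` of these users active per slot, and `hone`
prevents two jobs of one user from colliding. Stream `none` is the coded multicast, stream `some (j,
κ)` a job of user `j`. -/
theorem isAchievableDelay_of_schedule {L K₁ K₂ N t g : ℕ} (γ₁ : ℝ) (hL : 1 ≤ L)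
    (ht : (K₁ : ℝ) * γ₁ = t) (hg : t + g = K₁) (hg0 : 0 < g) (ht0 : 0 < t)
    (hload : K₂ * (t + 1) ≤ (L - 1) * g) (hone : K₂ = 0 ∨ t + 1 ≤ g)
    (H : Channel L K₁ K₂) (hH : InGeneralPosition H) :
    IsAchievableDelay N γ₁ 0 H (g / (t + 1)) := by
  classical
  have e : ∀ τ : {τ : Finset (Fin K₁) // τ.card = t}, {κ // κ ∉ τ.1} ≃ Fin g := fun τ =>
    Fintype.equivFinOfCardEq (by
      rw [Fintype.card_subtype_compl, Fintype.card_fin, Fintype.card_coe, τ.2]; omega)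
  have pos : ∀ χ : {χ : Finset (Fin K₁) // χ.card = t + 1}, {κ // κ ∈ χ.1} ≃ Fin (t + 1) :=
    fun χ => Fintype.equivFinOfCardEq (by rw [Fintype.card_coe, χ.2])
  let Piece := {τ : Finset (Fin K₁) // τ.card = t} × Fin g
  let Slot := {χ : Finset (Fin K₁) // χ.card = t + 1} × Fin g
  let act : Slot → Fin K₂ → Fin K₁ → Prop := fun s j κ =>
    ∃ h : κ ∈ s.1.1, ((j : ℕ) * (t + 1) + pos s.1 ⟨κ, h⟩) % g = s.2
  let Act : Slot → Finset (Fin K₂) := fun s => Finset.univ.filter fun j => ∃ κ, act s j κ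
  have hAct : ∀ s, (Act s).card ≤ L - 1 := fun s =>
    card_jobs_le K₂ (t + 1) g (L - 1) s.2 hg0 hload _ fun j hj => by
      obtain ⟨κ, h, hκ⟩ := (Finset.mem_filter.1 hj).2
      exact ⟨_, (pos s.1 ⟨κ, h⟩).2, hκ⟩
  -- The users at which a stream is nulled. For an active `j`, adding `κ` replaces removing `j`, so
  -- the count stays at most `L - 1`; for an inactive `j` it could reach `L`, but then the stream
  -- carries no pieces.
  let A : Slot → Option (Fin K₂ × Fin K₁) → Finset (User K₁ K₂) := fun s st =>
    st.elim ((Act s).image Sum.inr)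
      fun p => insert (Sum.inl p.2) (((Act s).erase p.1).image Sum.inr)
  have hbeam : ∀ s st, ∃ v : Fin L → ℂ, (∀ p ∈ st, p.1 ∈ Act s) →
      (∀ k ∈ A s st, ∑ l, (starRingEnd ℂ) (H k l) * v l = 0) ∧
      ∀ k ∉ A s st, ∑ l, (starRingEnd ℂ) (H k l) * v l ≠ 0 := by
    intro s st
    by_cases hst : ∀ p ∈ st, p.1 ∈ Act s
    · obtain ⟨v, hv⟩ := hH.exists_beam (A s st) (by
        have h1 := hAct s
        rcases st with _ | ⟨j, κ⟩
        · have := Finset.card_image_le (s := Act s) (f := (Sum.inr : Fin K₂ → User K₁ K₂))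
          simp only [A, Option.elim]
          omega
        · have h2 := Finset.card_insert_le (Sum.inl κ : User K₁ K₂)
            (((Act s).erase j).image Sum.inr)
          have h3 := Finset.card_image_le (s := (Act s).erase j)
            (f := (Sum.inr : Fin K₂ → User K₁ K₂))
          have h4 : j ∈ Act s := hst (j, κ) rfl
          have h5 := Finset.card_erase_add_one h4
          simp only [A, Option.elim]
          omega)
      exact ⟨v, fun _ => hv⟩
    · exact ⟨0, fun h => absurd h hst⟩
  choose v hv using hbeam
  let Z : User K₁ K₂ → Finset Piece := fun k =>
    k.elim (fun i => Finset.univ.filter fun p => i ∈ p.1.1) fun _ => ∅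
  let M : (User K₁ K₂ → Fin N) → Slot → Option (Fin K₂ × Fin K₁) → Finset (Fin N × Piece) :=
    fun d s st => Finset.univ.filter fun q => st.elim
      (∃ k, q.1 = d (Sum.inl k) ∧ k ∉ q.2.1.1 ∧ insert k q.2.1.1 = s.1.1 ∧ q.2.2 = s.2)
      fun p => act s p.1 p.2 ∧ q.1 = d (Sum.inr p.1) ∧
        ∃ h : p.2 ∉ q.2.1.1, insert p.2 q.2.1.1 = s.1.1 ∧ q.2.2 = e q.2.1 ⟨p.2, h⟩
  have hinsert : ∀ (τ τ' : {τ : Finset (Fin K₁) // τ.card = t}) (κ : Fin K₁), κ ∉ τ.1 → κ ∉ τ'.1 →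
      insert κ τ.1 = insert κ τ'.1 → τ = τ' := by
    intro τ τ' κ h h' hh
    apply Subtype.ext
    rw [← Finset.erase_insert h, hh, Finset.erase_insert h']
  have hcached : ∀ d s k j κ, k ∈ s.1.1 → k ≠ κ →
      ∀ q ∈ M d s (some (j, κ)), q.2 ∈ Z (Sum.inl k) := by
    intro d s k j κ hk hkκ q hq
    obtain ⟨-, -, h, hins, -⟩ := (Finset.mem_filter.1 hq).2
    rw [← hins] at hk
    exact Finset.mem_filter.2 ⟨Finset.mem_univ _, Finset.mem_of_mem_insert_of_ne hk hkκ⟩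
  have hinact : ∀ d s k j κ, ¬ act s j κ → ∀ q ∈ M d s (some (j, κ)), q.2 ∈ Z k :=
    fun d s k j κ h q hq => absurd (Finset.mem_filter.1 hq).2.1 h
  have hActmem : ∀ {s j κ}, act s j κ → j ∈ Act s := fun {s j κ} h =>
    Finset.mem_filter.2 ⟨Finset.mem_univ _, κ, h⟩
  have hvsome : ∀ {s j κ}, act s j κ → ∀ p ∈ some (j, κ), p.1 ∈ Act s := by
    rintro s j κ h p hp
    obtain rfl := Option.mem_some_iff.1 hp
    exact hActmem h
  have hchoose : (Fintype.card Slot : ℝ) / Fintype.card Piece = g / (t + 1) := by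
    have h1 : 0 < K₁.choose t := Nat.choose_pos (by omega)
    have h2 := Nat.choose_succ_right_eq K₁ t
    have h3 : K₁ - t = g := by omega
    rw [h3] at h2
    have h4 : (K₁.choose (t + 1) : ℝ) * (t + 1) = K₁.choose t * g := by exact_mod_cast h2
    simp only [Slot, Piece, Fintype.card_prod, Fintype.card_finset_len, Fintype.card_fin]
    push_cast
    have h5 : (0 : ℝ) < K₁.choose t := by exact_mod_cast h1
    have h6 : (0 : ℝ) < g := by exact_mod_cast hg0
    rw [div_eq_div_iff (by positivity) (by positivity)]
    linear_combination (g : ℝ) * h4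
  -- Absorption identity `t * (K₁ choose t) = K₁ * ((K₁ - 1) choose (t - 1))`: each cache is filled
  -- exactly.
  have hcardZ : ∀ i, (Z (Sum.inl i)).card * K₁ = t * Fintype.card Piece := by
    intro i
    have h1 : (Z (Sum.inl i)).card = (K₁ - 1).choose (t - 1) * g := by
      have h2 : ((Finset.univ.erase i).powersetCard (t - 1) ×ˢ
          (Finset.univ : Finset (Fin g))).card = (K₁ - 1).choose (t - 1) * g := by
        rw [Finset.card_product, Finset.card_powersetCard, Finset.card_erase_of_mem
          (Finset.mem_univ i), Finset.card_univ, Fintype.card_fin, Finset.card_univ,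
          Fintype.card_fin]
      rw [← h2]
      refine Finset.card_bij (fun p _ => (p.1.1.erase i, p.2)) ?_ ?_ ?_
      · rintro ⟨τ, r⟩ hp
        have hi : i ∈ τ.1 := (Finset.mem_filter.1 hp).2
        simp only [Finset.mem_product, Finset.mem_powersetCard, Finset.mem_univ, and_true]
        exact ⟨Finset.erase_subset_erase _ (Finset.subset_univ _), by
          rw [Finset.card_erase_of_mem hi, τ.2]⟩
      · rintro ⟨τ, r⟩ hp ⟨τ', r'⟩ hp' h
        have hi : i ∈ τ.1 := (Finset.mem_filter.1 hp).2
        have hi' : i ∈ τ'.1 := (Finset.mem_filter.1 hp').2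
        rw [Prod.mk.injEq] at h
        refine Prod.ext (Subtype.ext ?_) h.2
        rw [← Finset.insert_erase hi, ← Finset.insert_erase hi', h.1]
      · rintro ⟨σ, r⟩ hp
        simp only [Finset.mem_product, Finset.mem_powersetCard, Finset.mem_univ, and_true] at hp
        have hi : i ∉ σ := fun h => by simpa using hp.1 h
        refine ⟨(⟨insert i σ, by rw [Finset.card_insert_of_notMem hi, hp.2]; omega⟩, r),
          Finset.mem_filter.2 ⟨Finset.mem_univ _, Finset.mem_insert_self _ _⟩, ?_⟩
        simp only [Finset.erase_insert hi]
    have h3 := Nat.add_one_mul_choose_eq (K₁ - 1) (t - 1)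
    rw [show K₁ - 1 + 1 = K₁ by omega, show t - 1 + 1 = t by omega] at h3
    rw [h1]
    simp only [Piece, Fintype.card_prod, Fintype.card_finset_len, Fintype.card_fin]
    linear_combination g * h3
  have hcard_pos : ∀ r ≤ K₁, Nonempty {τ : Finset (Fin K₁) // τ.card = r} := fun r hr => by
    obtain ⟨τ, -, hτ⟩ := Finset.exists_subset_card_eq (s := (Finset.univ : Finset (Fin K₁)))
      (n := r) (by simpa using hr)
    exact ⟨⟨τ, hτ⟩⟩
  have : Nonempty Piece := by
    have := hcard_pos t (by omega)
    exact ⟨Classical.arbitrary _, ⟨0, hg0⟩⟩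
  have : Nonempty Slot := by
    have := hcard_pos (t + 1) (by omega)
    exact ⟨Classical.arbitrary _, ⟨0, hg0⟩⟩
  rw [← hchoose]
  refine isAchievableDelay_of_slots H γ₁ 0 Z (fun i => ?_) (fun j => by simp [Z]) M
    (fun _ => v) fun d _ k p hp => ?_
  · have h1 : (0 : ℝ) < K₁ := by exact_mod_cast (by omega : 0 < K₁)
    have h2 : ((Z (Sum.inl i)).card : ℝ) * K₁ = t * Fintype.card Piece := by
      exact_mod_cast hcardZ i
    rw [← ht] at h2
    have h3 : ((Z (Sum.inl i)).card : ℝ) * K₁ = (γ₁ * Fintype.card Piece) * K₁ := by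
      linear_combination h2
    exact (mul_right_cancel₀ h1.ne' h3).le
  obtain ⟨τ, r⟩ := p
  rcases k with k | j
  · have hk : k ∉ τ.1 := by simpa [Z] using hp
    refine ⟨(⟨insert k τ.1, by rw [Finset.card_insert_of_notMem hk, τ.2]⟩, r), none, ?_, ?_, ?_, ?_⟩
    · exact Finset.mem_filter.2 ⟨Finset.mem_univ _, k, rfl, hk, rfl, rfl⟩
    · rintro ⟨f, τ', r'⟩ hq hne
      obtain ⟨k', hf, hk', hins, hr⟩ := (Finset.mem_filter.1 hq).2
      simp only at hf hk' hins hr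
      by_cases hkk : k = k'
      · subst hkk
        exact absurd (by rw [hf, hr, hinsert τ' τ k hk' hk hins]) hne
      · have : k ∈ insert k' τ'.1 := by rw [hins]; exact Finset.mem_insert_self _ _
        exact Finset.mem_filter.2 ⟨Finset.mem_univ _, Finset.mem_of_mem_insert_of_ne this hkk⟩
    · exact (hv _ none (by simp)).2 _ (by simp [A])
    · rintro (_ | ⟨j, κ⟩) hst
      · exact absurd rfl hst
      by_cases ha : act (⟨insert k τ.1, by rw [Finset.card_insert_of_notMem hk, τ.2]⟩, r) j κ
      · by_cases hkκ : k = κ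
        · left
          exact (hv _ (some (j, κ)) (hvsome ha)).1 _ (by simp [A, hkκ])
        · right
          exact hcached d _ k j κ (Finset.mem_insert_self _ _) hkκ
      · exact Or.inr (hinact d _ _ j κ ha)
  · have hone' : t + 1 ≤ g := hone.resolve_left fun h => by subst h; exact j.elim0
    obtain ⟨⟨κ, hκ⟩, hκr⟩ := (e τ).surjective r
    obtain ⟨χ, hχ⟩ : ∃ χ : {χ : Finset (Fin K₁) // χ.card = t + 1}, χ.1 = insert κ τ.1 :=
      ⟨⟨insert κ τ.1, by rw [Finset.card_insert_of_notMem hκ, τ.2]⟩, rfl⟩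
    have hκχ : κ ∈ χ.1 := by rw [hχ]; exact Finset.mem_insert_self _ _
    obtain ⟨s, hs⟩ : ∃ s : Slot, s = (χ, ⟨((j : ℕ) * (t + 1) + pos χ ⟨κ, hκχ⟩) % g,
      Nat.mod_lt _ hg0⟩) := ⟨_, rfl⟩
    have hact : act s j κ := by
      subst hs
      exact ⟨hκχ, rfl⟩
    have hs1 : s.1 = χ := by rw [hs]
    refine ⟨s, some (j, κ), ?_, ?_, ?_, ?_⟩
    · exact Finset.mem_filter.2 ⟨Finset.mem_univ _, hact, rfl, hκ, by rw [hs1, hχ], hκr.symm⟩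
    · rintro ⟨f, τ', r'⟩ hq hne
      obtain ⟨-, hf, hκ', hins, hr⟩ := (Finset.mem_filter.1 hq).2
      simp only at hf hκ' hins hr
      rw [hs1, hχ] at hins
      obtain rfl := hinsert τ' τ κ hκ' hκ hins
      exact absurd (by rw [hf, hr, hκr]) hne
    · exact (hv s (some (j, κ)) (hvsome hact)).2 _ (by simp [A])
    · rintro (_ | ⟨j', κ'⟩) hst
      · left
        exact (hv s none (by simp)).1 _ (by simpa [A] using hActmem hact)
      by_cases ha : act s j' κ'
      · left
        refine (hv s (some (j', κ')) (hvsome ha)).1 _ ?_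
        by_cases hjj : j = j'
        · subst hjj
          exfalso
          apply hst
          obtain ⟨h1, h1'⟩ := hact
          obtain ⟨h2, h2'⟩ := ha
          -- Two streams for the same user in one slot have positions congruent mod `g`, and these
          -- are below `t + 1 ≤ g`, hence equal.
          have h3 : (pos s.1 ⟨κ, h1⟩ : ℕ) ≡ pos s.1 ⟨κ', h2⟩ [MOD g] :=
            Nat.ModEq.add_left_cancel' _ (h1'.trans h2'.symm)
          have h4 := Nat.ModEq.eq_of_lt_of_lt h3
            ((pos s.1 ⟨κ, h1⟩).2.trans_le hone') ((pos s.1 ⟨κ', h2⟩).2.trans_le hone')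
          have h5 := (pos s.1).injective (Fin.ext h4)
          rw [Subtype.mk.injEq] at h5
          rw [h5]
        · have := hActmem hact
          simp [A, hjj, this]
      · exact Or.inr (hinact d s _ j' κ' ha)

end Schedule

/-! ### A Gibbs inequality for decoding. -/

section Converse

/-- The density `g` is positive and its logarithm has mean `-q`. -/
def HasLogMean {E : Type*} [MeasurableSpace E] (μ : Measure E) (g : E → ℝ) (q : ℝ) : Prop :=
  (∀ x, 0 < g x) ∧ Integrable (fun x => Real.log (g x)) μ ∧ ∫ x, Real.log (g x) ∂μ = -q

theorem HasLogMean.pi {ι : Type*} [Fintype ι] {E : ι → Type*}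
    [∀ i, MeasurableSpace (E i)] {μ : ∀ i, Measure (E i)} [∀ i, IsProbabilityMeasure (μ i)]
    {g : ∀ i, E i → ℝ} {q : ι → ℝ} (h : ∀ i, HasLogMean (μ i) (g i) (q i)) :
    HasLogMean (Measure.pi μ) (fun x => ∏ i, g i (x i)) (∑ i, q i) := by
  have hlog : (fun x : ∀ i, E i => Real.log (∏ i, g i (x i))) =
      fun x => ∑ i, Real.log (g i (x i)) := by
    ext x
    exact Real.log_prod fun i _ => ((h i).1 _).ne'
  have hint : ∀ i, Integrable (fun x : ∀ i, E i => Real.log (g i (x i))) (Measure.pi μ) :=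
    fun i => integrable_comp_eval (h i).2.1
  refine ⟨fun x => Finset.prod_pos fun i _ => (h i).1 _, ?_, ?_⟩
  · rw [hlog]
    exact integrable_finsetSum _ fun i _ => hint i
  · rw [hlog, integral_finsetSum _ fun i _ => hint i, ← Finset.sum_neg_distrib]
    refine Finset.sum_congr rfl fun i _ => ?_
    rw [integral_comp_eval (μ := μ) (f := fun y => Real.log (g i y)) (h i).2.1.1, (h i).2.2]

/-- The linear term is centred; the relative entropy between the noise and its translate by `d` is
therefore `‖d‖ ^ 2` nats. -/
theorem hasLogMean_complexGaussian (d : ℂ) :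
    HasLogMean complexGaussian
      (fun w => Real.exp (-(2 * (w * (starRingEnd ℂ) d).re) - ‖d‖ ^ 2)) (‖d‖ ^ 2) := by
  obtain ⟨h1, h2⟩ := integral_re_mul_complexGaussian ((starRingEnd ℂ) d)
  have h3 : Integrable (fun w : ℂ => -(2 * (w * (starRingEnd ℂ) d).re)) complexGaussian :=
    (h1.const_mul 2).neg
  refine ⟨fun w => Real.exp_pos _, ?_, ?_⟩
  · simp_rw [Real.log_exp]
    exact h3.sub (integrable_const _)
  · simp_rw [Real.log_exp]
    rw [integral_sub h3 (integrable_const _), integral_neg, integral_const_mul, h2]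
    simp

/-- Gibbs' inequality for decoding. The signal of the message `m` is `a m`, the decoding region is
`A m`, and `B (z m)` is a quantization of the signal, whose index has weight `π (z m)`. -/
theorem mul_success_le {M ζ E : Type*} [Fintype M] [Nonempty M] [AddCommGroup E]
    [MeasurableSpace E] [MeasurableAdd E] (μ : Measure E) [IsProbabilityMeasure μ]
    (a : M → E) (z : M → ζ) (B : ζ → E) (A : M → Set E) (hA : ∀ m, MeasurableSet (A m))
    (S : Finset ζ) (hz : ∀ m, z m ∈ S) (π : ζ → ℝ) (hπ : ∀ i, 0 < π i) (hπS : ∑ i ∈ S, π i ≤ 1)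
    (g : M → E → ℝ) (q : M → ℝ)
    (hshift : ∀ m, IsDensityShift μ (fun w => w + (a m - B (z m))) (g m))
    (hlog : ∀ m, HasLogMean μ (g m) (q m)) (ρ l : ℝ) (hρ : 0 ≤ ρ)
    (hcard : ∀ y, ({m | y ∈ A m}.ncard : ℝ) ≤ ρ * Fintype.card M) :
    l * ((∑ m, μ.real {w | a m + w ∈ A m}) / Fintype.card M) ≤
      Real.log (1 + ρ * Real.exp l) + (∑ m, (q m - Real.log (π (z m)))) / Fintype.card M := by
  classical
  set Z := 1 + ρ * Real.exp l with hZ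
  have hZ0 : 0 < Z := by positivity
  have hM : (0 : ℝ) < Fintype.card M := by exact_mod_cast Fintype.card_pos
  -- Test function whose logarithm is `l` on success and `0` otherwise. Averaged over the messages
  -- it is at most `Z` at every output `y`, by `hcard`.
  let φ : M → E → ℝ := fun m y => (A m).indicator (fun _ => Real.exp l) y +
    (A m)ᶜ.indicator (fun _ => 1) y
  have hφm : ∀ m, Measurable (φ m) := fun m =>
    (measurable_const.indicator (hA m)).add (measurable_const.indicator (hA m).compl)
  have hφin : ∀ m y, y ∈ A m → φ m y = Real.exp l := fun m y h => by simp [φ, h]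
  have hφout : ∀ m y, y ∉ A m → φ m y = 1 := fun m y h => by simp [φ, h]
  have hφ0 : ∀ m y, 0 < φ m y := by
    intro m y
    by_cases h : y ∈ A m
    · rw [hφin m y h]; exact Real.exp_pos _
    · rw [hφout m y h]; exact one_pos
  have hφint : ∀ m x, Integrable (fun w => φ m (x + w)) μ := by
    intro m x
    refine Integrable.of_bound ((hφm m).comp (measurable_const_add x)).aestronglyMeasurable
      (Real.exp l + 1) (ae_of_all _ fun w => ?_)
    rw [Real.norm_of_nonneg (hφ0 _ _).le]
    by_cases h : x + w ∈ A m
    · rw [hφin m _ h]; linarith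
    · rw [hφout m _ h]; linarith [Real.exp_pos l]
  have hmsg : ∀ m, l * μ.real {w | a m + w ∈ A m} + Real.log (π (z m)) - q m - Real.log Z ≤
      π (z m) / Z * ∫ w, φ m (B (z m) + w) ∂μ - 1 := by
    intro m
    have hset : MeasurableSet {w | a m + w ∈ A m} := measurable_const_add (a m) (hA m)
    have hind : Integrable ({w | a m + w ∈ A m}.indicator fun _ => l) μ :=
      (integrable_const l).indicator hset
    have hadd : Integrable (fun w => {w | a m + w ∈ A m}.indicator (fun _ => l) w +
        Real.log (g m w)) μ := hind.add (hlog m).2.1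
    have hint2 := (hshift m).integrable (hφint m (B (z m)))
    rw [← (hshift m).integral_eq (f := fun w => φ m (B (z m) + w))
      ((hφm m).comp (measurable_const_add _))]
    have hshift' : ∀ w, B (z m) + (w + (a m - B (z m))) = a m + w := fun w => by abel
    simp_rw [hshift'] at hint2 ⊢
    -- This is `log x ≤ x - 1` under the true law. On the right the density `g m` moves the centre
    -- from `a m` to the quantized signal.
    have h1 : ∫ w, ({w | a m + w ∈ A m}.indicator (fun _ => l) w + Real.log (g m w) +
        (Real.log (π (z m)) - Real.log Z)) ∂μ ≤
        ∫ w, (π (z m) / Z * (g m w * φ m (a m + w)) - 1) ∂μ := by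
      refine integral_mono (hadd.add (integrable_const _))
        ((hint2.const_mul _).sub (integrable_const _)) fun w => ?_
      have hg := (hlog m).1 w
      have hx : 0 < π (z m) / Z * (g m w * φ m (a m + w)) :=
        mul_pos (div_pos (hπ _) hZ0) (mul_pos hg (hφ0 _ _))
      have h2 := Real.log_le_sub_one_of_pos hx
      rw [Real.log_mul (div_pos (hπ _) hZ0).ne' (mul_pos hg (hφ0 _ _)).ne',
        Real.log_div (hπ _).ne' hZ0.ne', Real.log_mul hg.ne' (hφ0 _ _).ne'] at h2
      have h3 : Real.log (φ m (a m + w)) = {w | a m + w ∈ A m}.indicator (fun _ => l) w := by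
        by_cases h : a m + w ∈ A m
        · rw [hφin m _ h, Real.log_exp, Set.indicator_of_mem (by exact h)]
        · rw [hφout m _ h, Real.log_one, Set.indicator_of_notMem (by exact h)]
      rw [h3] at h2
      simp only
      linarith
    rw [integral_add hadd (integrable_const _),
      integral_add hind (hlog m).2.1, integral_indicator hset, (hlog m).2.2,
      integral_sub (hint2.const_mul _) (integrable_const _), integral_const_mul] at h1
    simp only [integral_const, measureReal_restrict_apply_univ, probReal_univ, smul_eq_mul,
      one_mul] at h1
    linarith
  have hsum := Finset.sum_le_sum fun m (_ : m ∈ Finset.univ) => hmsg m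
  -- Replacing the single centre `B (z m)` by the mixture over all of `S` removes the dependence of
  -- the output law on `m`, so the pointwise bound on `∑ m, φ m y` applies.
  have htotal : ∑ m, π (z m) * ∫ w, φ m (B (z m) + w) ∂μ ≤ Z * Fintype.card M := by
    have h1 : ∀ m, π (z m) * ∫ w, φ m (B (z m) + w) ∂μ ≤
        ∑ i ∈ S, π i * ∫ w, φ m (B i + w) ∂μ := fun m =>
      Finset.single_le_sum (f := fun i => π i * ∫ w, φ m (B i + w) ∂μ)
        (fun i _ => mul_nonneg (hπ i).le (integral_nonneg fun w => (hφ0 _ _).le)) (hz m)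
    refine (Finset.sum_le_sum fun m _ => h1 m).trans ?_
    rw [Finset.sum_comm]
    have h2 : ∀ i, ∑ m, π i * ∫ w, φ m (B i + w) ∂μ ≤ π i * (Z * Fintype.card M) := by
      intro i
      rw [← Finset.mul_sum, ← integral_finsetSum _ fun m _ => hφint m (B i)]
      refine mul_le_mul_of_nonneg_left ?_ (hπ i).le
      have h3 : ∀ y, ∑ m, φ m y ≤ Z * Fintype.card M := by
        intro y
        have h4 : ∀ m, φ m y ≤ 1 + if y ∈ A m then Real.exp l else 0 := by
          intro m
          by_cases h : y ∈ A m
          · rw [hφin m _ h, if_pos h]; linarith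
          · rw [hφout m _ h, if_neg h]; linarith
        refine (Finset.sum_le_sum fun m _ => h4 m).trans ?_
        rw [Finset.sum_add_distrib, ← Finset.sum_filter, Finset.sum_const, Finset.sum_const,
          nsmul_eq_mul, nsmul_eq_mul, Finset.card_univ]
        have h5 : ((Finset.univ.filter fun m => y ∈ A m).card : ℝ) ≤ ρ * Fintype.card M := by
          refine le_trans (le_of_eq ?_) (hcard y)
          rw [← Set.ncard_coe_finset]
          simp
        have := mul_le_mul_of_nonneg_right h5 (Real.exp_pos l).le
        rw [hZ]
        linarith
      calc _ ≤ ∫ _w : E, Z * Fintype.card M ∂μ :=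
            integral_mono (integrable_finsetSum _ fun m _ => hφint m (B i)) (integrable_const _)
              fun w => h3 (B i + w)
        _ = _ := by simp
    refine (Finset.sum_le_sum fun i _ => h2 i).trans ?_
    rw [← Finset.sum_mul]
    have : 0 ≤ Z * Fintype.card M := by positivity
    nlinarith
  have h3 : ∑ m, (π (z m) / Z * ∫ w, φ m (B (z m) + w) ∂μ - 1) ≤ 0 := by
    rw [Finset.sum_sub_distrib]
    simp_rw [div_mul_eq_mul_div]
    rw [← Finset.sum_div]
    simp only [Finset.sum_const, Finset.card_univ, nsmul_eq_mul, mul_one]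
    rw [sub_nonpos, div_le_iff₀ hZ0]
    linarith
  have h4 := hsum.trans h3
  rw [Finset.sum_sub_distrib, Finset.sum_sub_distrib, Finset.sum_add_distrib, ← Finset.mul_sum]
    at h4
  simp only [Finset.sum_const, Finset.card_univ, nsmul_eq_mul] at h4
  rw [← mul_div_assoc, div_le_iff₀ hM, add_mul, div_mul_cancel₀ _ hM.ne', Finset.sum_sub_distrib]
  linarith

end Converse

/-! ### The single-antenna bound on the number of recoverable bits. -/

section Capacity

/-- Quantization of a complex number to a Gaussian integer. -/
noncomputable def gaussRound (x : ℂ) : ℤ × ℤ := (round x.re, round x.im)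

/-- The Gaussian integer with given real and imaginary parts. -/
noncomputable def gaussInt (p : ℤ × ℤ) : ℂ := ⟨p.1, p.2⟩

theorem norm_sub_gaussInt_gaussRound_le (x : ℂ) : ‖x - gaussInt (gaussRound x)‖ ^ 2 ≤ 1 := by
  rw [Complex.sq_norm, Complex.normSq_apply]
  simp only [gaussInt, gaussRound, Complex.sub_re, Complex.sub_im]
  have h1 := abs_le.1 (abs_sub_round x.re)
  have h2 := abs_le.1 (abs_sub_round x.im)
  nlinarith

/-- A weight on the Gaussian integers that spreads over those of square norm about `P`. -/
noncomputable def gaussWeight (P : ℝ) (p : ℤ × ℤ) : ℝ :=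
  Real.exp (-(1 / √P * |(p.1 : ℝ)|)) * Real.exp (-(1 / √P * |(p.2 : ℝ)|)) / (2 * (1 + √P)) ^ 2

theorem gaussWeight_pos (P : ℝ) (p : ℤ × ℤ) : 0 < gaussWeight P p := by
  unfold gaussWeight
  positivity

theorem sum_gaussWeight_le {P : ℝ} (hP : 1 ≤ P) (S₁ S₂ : Finset ℤ) :
    ∑ p ∈ S₁ ×ˢ S₂, gaussWeight P p ≤ 1 := by
  have hs : 0 < √P := Real.sqrt_pos.2 (by linarith)
  have h1 := sum_exp_neg_abs_le (1 / √P) (by positivity) S₁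
  have h2 := sum_exp_neg_abs_le (1 / √P) (by positivity) S₂
  simp only [gaussWeight]
  rw [← Finset.sum_div, Finset.sum_product]
  simp_rw [← Finset.mul_sum]
  rw [← Finset.sum_mul, div_le_one (by positivity), sq]
  rw [one_div_one_div] at h1 h2
  exact mul_le_mul h1 h2 (Finset.sum_nonneg fun _ _ => (Real.exp_pos _).le) (by positivity)

/-- The normalizer is at most `16 * P`, and `|r| / √P ≤ 1 / 2 + r ^ 2 / (2 * P)` turns the
exponential tails into a term that the power constraint controls on average. -/
theorem neg_log_gaussWeight_gaussRound_le {P : ℝ} (hP : 1 ≤ P) (x : ℂ) :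
    -Real.log (gaussWeight P (gaussRound x)) ≤
      Real.log P + (Real.log 16 + 3) + ‖x‖ ^ 2 / (2 * P) := by
  have hs : 1 ≤ √P := Real.one_le_sqrt.2 hP
  have hs2 : √P ^ 2 = P := Real.sq_sqrt (by linarith)
  have hround : ∀ r : ℝ, 1 / √P * |((round r : ℤ) : ℝ)| ≤ 3 / 2 + r ^ 2 / (2 * P) := by
    intro r
    have h1 : |((round r : ℤ) : ℝ)| ≤ |r| + 1 := by
      have h2 := abs_sub_abs_le_abs_sub ((round r : ℤ) : ℝ) r
      have h3 := abs_sub_round r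
      rw [abs_sub_comm] at h3
      linarith
    have h4 : 1 / √P * |((round r : ℤ) : ℝ)| ≤ 1 / √P * (|r| + 1) :=
      mul_le_mul_of_nonneg_left h1 (by positivity)
    refine h4.trans ?_
    have h5 : r ^ 2 / (2 * P) = (|r| / √P) ^ 2 / 2 := by
      rw [div_pow, sq_abs, hs2]; field_simp
    have h6 : 1 / √P ≤ 1 := by rw [div_le_one (by linarith)]; exact hs
    rw [h5, mul_add, one_div_mul_eq_div, mul_one]
    nlinarith [sq_nonneg (|r| / √P - 1)]
  have h7 : Real.log ((2 * (1 + √P)) ^ 2) ≤ Real.log P + Real.log 16 := by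
    rw [← Real.log_mul (by linarith) (by norm_num)]
    refine Real.log_le_log (by positivity) ?_
    nlinarith
  rw [gaussWeight, Real.log_div (by positivity) (by positivity),
    Real.log_mul (by positivity) (by positivity), Real.log_exp, Real.log_exp, Complex.sq_norm,
    Complex.normSq_apply]
  have h8 := hround x.re
  have h9 := hround x.im
  simp only [gaussRound]
  have h10 : (x.re * x.re + x.im * x.im) / (2 * P) = x.re ^ 2 / (2 * P) + x.im ^ 2 / (2 * P) := by
    ring
  rw [h10]
  linarith

/-- The library bits in `J` are determined by the other bits, if every user can recover its file
from its cached bits and the received symbols. -/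
def Scheme.Recoverable {L K₁ K₂ N F n : ℕ} (s : Scheme L K₁ K₂ N F n) (d : User K₁ K₂ → Fin N)
    (J : Finset (Fin N × Fin F)) : Prop :=
  ∀ W W' : Library N F, (∀ p ∉ J, W p.1 p.2 = W' p.1 p.2) →
    (∀ k, (∀ p ∈ s.cache k, W p.1 p.2 = W' p.1 p.2) → W (d k) = W' (d k)) → W = W'

theorem ncard_library_le {N F : ℕ} (J : Finset (Fin N × Fin F)) (S : Set (Library N F))
    (hS : ∀ W ∈ S, ∀ W' ∈ S, (∀ p ∉ J, W p.1 p.2 = W' p.1 p.2) → W = W') :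
    (S.ncard : ℝ) ≤ (1 / 2) ^ J.card * Fintype.card (Library N F) := by
  classical
  have h1 : S.ncard ≤ 2 ^ (N * F - J.card) := by
    have h2 : Fintype.card ({p // p ∉ J} → Bool) = 2 ^ (N * F - J.card) := by
      rw [Fintype.card_fun, Fintype.card_bool, Fintype.card_subtype_compl, Fintype.card_prod,
        Fintype.card_fin, Fintype.card_fin, Fintype.card_coe]
    rw [← h2, ← Nat.card_eq_fintype_card, ← Set.ncard_univ]
    refine Set.ncard_le_ncard_of_injOn (fun W (p : {p // p ∉ J}) => W p.1.1 p.1.2)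
      (fun _ _ => Set.mem_univ _) fun W hW W' hW' h => hS W hW W' hW' fun p hp => ?_
    exact congrFun h ⟨p, hp⟩
  have h3 : J.card ≤ N * F := by
    have := Finset.card_le_univ J
    simpa using this
  have h4 : Fintype.card (Library N F) = 2 ^ (N * F) := by
    simp only [Fintype.card_fun, Fintype.card_bool, Fintype.card_fin]
    rw [← pow_mul, mul_comm]
  rw [h4]
  have h5 : (S.ncard : ℝ) ≤ 2 ^ (N * F - J.card) := by exact_mod_cast h1
  refine h5.trans (le_of_eq ?_)
  obtain ⟨r, hr⟩ := Nat.exists_eq_add_of_le h3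
  rw [hr, Nat.add_sub_cancel_left]
  push_cast
  rw [pow_add, ← mul_assoc, ← mul_pow]
  norm_num

/-- Converse for a single transmit antenna: up to a constant per channel use, `n` channel uses convey
at most `n * log P` nats in total. -/
theorem recoverable_card_le {K₁ K₂ : ℕ} (h : Channel 1 K₁ K₂) :
    ∃ c : ℝ, 0 ≤ c ∧ ∀ (N F n : ℕ) (s : Scheme 1 K₁ K₂ N F n) (P : ℝ), 1 ≤ P →
      s.PowerConstraint P → ∀ d : User K₁ K₂ → Fin N, Function.Injective d → ∀ η : ℝ,
      (∀ k, s.errorProb h d k ≤ η) → ∀ J, s.Recoverable d J → ∀ κ : ℝ, 0 ≤ κ →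
      (J.card * Real.log 2 + κ) * (1 - Fintype.card (User K₁ K₂) * η) ≤
        κ + Real.exp (-κ) + n * (Real.log P + c) := by
  classical
  -- `log 16 + 3` comes from the quantizer weight, `1` covers the average of `‖x‖ ^ 2 / (2 * P)`,
  -- and the sum bounds the relative entropy caused by rounding.
  refine ⟨Real.log 16 + 4 + ∑ k, ‖h k 0‖ ^ 2, by
    have := Real.log_nonneg (by norm_num : (1 : ℝ) ≤ 16)
    positivity, fun N F n s P hP hpow d hd η hη J hJ κ hκ => ?_⟩
  -- All users are treated as one receiver with independent noises; the error probabilities depend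
  -- on the marginals only, so a union bound suffices.
  let μ : Measure (User K₁ K₂ → Fin n → ℂ) := Measure.pi fun _ => Measure.pi fun _ => complexGaussian
  let x : Library N F → Fin n → ℂ := fun W i => s.encode d W i 0
  let sig : (Fin n → ℂ) → User K₁ K₂ → Fin n → ℂ := fun x k i => (starRingEnd ℂ) (h k 0) * x i
  let z : Library N F → Fin n → ℤ × ℤ := fun W i => gaussRound (x W i)
  let B : (Fin n → ℤ × ℤ) → User K₁ K₂ → Fin n → ℂ := fun z => sig fun i => gaussInt (z i)
  let A : Library N F → Set (User K₁ K₂ → Fin n → ℂ) := fun W =>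
    {y | ∀ k, s.decode d k (fun p => W p.1.1 p.1.2) (y k) = W (d k)}
  have hA : ∀ W, MeasurableSet (A W) := fun W => by
    have : A W = ⋂ k, (fun y : User K₁ K₂ → Fin n → ℂ => y k) ⁻¹'
        (s.decode d k (fun p => W p.1.1 p.1.2) ⁻¹' {W (d k)}) := by
      ext y
      simp only [A, Set.mem_iInter, Set.mem_preimage, Set.mem_singleton_iff, Set.mem_ofPred_eq]
    rw [this]
    exact MeasurableSet.iInter fun k => measurable_pi_apply k
      (s.measurable_decode d k _ (measurableSet_singleton _))
  let S₁ : Finset ℤ := Finset.univ.image fun p : Library N F × Fin n => (z p.1 p.2).1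
  let S₂ : Finset ℤ := Finset.univ.image fun p : Library N F × Fin n => (z p.1 p.2).2
  let S : Finset (Fin n → ℤ × ℤ) := Fintype.piFinset fun _ => S₁ ×ˢ S₂
  have hz : ∀ W, z W ∈ S := fun W => Fintype.mem_piFinset.2 fun i => Finset.mem_product.2
    ⟨Finset.mem_image.2 ⟨(W, i), Finset.mem_univ _, rfl⟩,
      Finset.mem_image.2 ⟨(W, i), Finset.mem_univ _, rfl⟩⟩
  let π : (Fin n → ℤ × ℤ) → ℝ := fun z => ∏ i, gaussWeight P (z i)
  have hπS : ∑ z ∈ S, π z ≤ 1 := by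
    rw [← Finset.prod_univ_sum (fun _ => S₁ ×ˢ S₂) (fun _ p => gaussWeight P p)]
    exact Finset.prod_le_one (fun _ _ => Finset.sum_nonneg fun p _ => (gaussWeight_pos P p).le)
      fun _ _ => sum_gaussWeight_le hP _ _
  have hmain := mul_success_le μ (fun W => sig (x W)) z B A hA S hz π
    (fun z => Finset.prod_pos fun i _ => gaussWeight_pos P _) hπS _ _
    (fun W => IsDensityShift.pi fun k => IsDensityShift.pi fun i =>
      isDensityShift_complexGaussian ((sig (x W) - B (z W)) k i))
    (fun W => HasLogMean.pi fun k => HasLogMean.pi fun i =>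
      hasLogMean_complexGaussian ((sig (x W) - B (z W)) k i))
    -- With this `l` and `ρ`, `ρ * exp l = exp κ`. Libraries that all users decode correctly from
    -- the same `y` and that agree off `J` coincide by recoverability.
    ((1 / 2) ^ J.card) (J.card * Real.log 2 + κ) (by positivity) (fun y => by
      refine ncard_library_le J _ fun W hW W' hW' hWW => hJ W W' hWW fun k hk => ?_
      rw [← hW k, ← hW' k]
      congr 1
      ext p
      exact hk _ p.2)
  have hM : (0 : ℝ) < Fintype.card (Library N F) := by exact_mod_cast Fintype.card_pos
  have hsucc : 1 - Fintype.card (User K₁ K₂) * η ≤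
      (∑ W, μ.real {w | sig (x W) + w ∈ A W}) / Fintype.card (Library N F) := by
    have hW : ∀ W, 1 - ∑ k, (Measure.pi fun _ : Fin n => complexGaussian).real
        {w | s.output h d W k w ≠ W (d k)} ≤ μ.real {w | sig (x W) + w ∈ A W} := by
      intro W
      have hset : MeasurableSet {w | sig (x W) + w ∈ A W} := measurable_const_add (sig (x W)) (hA W)
      have hsub : {w | sig (x W) + w ∈ A W}ᶜ ⊆ ⋃ k, (fun w : User K₁ K₂ → Fin n → ℂ => w k) ⁻¹'
          {w | s.output h d W k w ≠ W (d k)} := by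
        intro w hw
        simp only [A, Set.mem_compl_iff, Set.mem_ofPred_eq, not_forall] at hw
        obtain ⟨k, hk⟩ := hw
        refine Set.mem_iUnion.2 ⟨k, ?_⟩
        simp only [Set.mem_preimage, Set.mem_ofPred_eq, Scheme.output]
        convert hk using 3
        ext i
        simp [Scheme.received, sig, x]
      have hmeas : ∀ k, MeasurableSet {w | s.output h d W k w ≠ W (d k)} := fun k => by
        have hout : Measurable fun w => s.output h d W k w :=
          (s.measurable_decode d k _).comp (measurable_pi_lambda _ fun i => by
            simp only [Scheme.received]
            fun_prop)
        exact (hout (measurableSet_singleton (W (d k)))).compl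
      have h1 := (measureReal_mono hsub).trans (measureReal_iUnion_fintype_le (μ := μ) _)
      rw [probReal_compl_eq_one_sub hset] at h1
      have h2 : ∀ k, μ.real ((fun w : User K₁ K₂ → Fin n → ℂ => w k) ⁻¹'
          {w | s.output h d W k w ≠ W (d k)}) =
          (Measure.pi fun _ : Fin n => complexGaussian).real
            {w | s.output h d W k w ≠ W (d k)} := fun k =>
        (measurePreserving_eval (fun _ : User K₁ K₂ =>
          Measure.pi fun _ : Fin n => complexGaussian) k).measureReal_preimage
            (hmeas k).nullMeasurableSet
      simp_rw [h2] at h1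
      linarith
    have h1 := Finset.sum_le_sum fun W (_ : W ∈ Finset.univ) => hW W
    rw [Finset.sum_sub_distrib, Finset.sum_comm] at h1
    have h2 := Finset.sum_le_sum fun k (_ : k ∈ Finset.univ) => hη k
    simp only [Scheme.errorProb] at h2
    rw [← Finset.sum_div, div_le_iff₀ hM] at h2
    rw [le_div_iff₀ hM]
    simp only [Finset.sum_const, Finset.card_univ, nsmul_eq_mul, mul_one] at h1 h2
    linarith
  have hquant : (∑ W, (∑ k, ∑ i, ‖(sig (x W) - B (z W)) k i‖ ^ 2 - Real.log (π (z W)))) /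
      Fintype.card (Library N F) ≤ n * (Real.log P + (Real.log 16 + 4 + ∑ k, ‖h k 0‖ ^ 2)) := by
    have hW : ∀ W, ∑ k, ∑ i, ‖(sig (x W) - B (z W)) k i‖ ^ 2 - Real.log (π (z W)) ≤
        n * (Real.log P + (Real.log 16 + 3 + ∑ k, ‖h k 0‖ ^ 2)) +
          (∑ i, ‖x W i‖ ^ 2) / (2 * P) := by
      intro W
      have h1 : ∑ k, ∑ i, ‖(sig (x W) - B (z W)) k i‖ ^ 2 ≤ n * ∑ k, ‖h k 0‖ ^ 2 := by
        rw [Finset.mul_sum]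
        refine Finset.sum_le_sum fun k _ => ?_
        calc ∑ i, ‖(sig (x W) - B (z W)) k i‖ ^ 2 ≤ ∑ _i : Fin n, ‖h k 0‖ ^ 2 := by
              refine Finset.sum_le_sum fun i _ => ?_
              have h2 : (sig (x W) - B (z W)) k i =
                  (starRingEnd ℂ) (h k 0) * (x W i - gaussInt (gaussRound (x W i))) := by
                simp only [sig, B, z, Pi.sub_apply]
                ring
              rw [h2, norm_mul, mul_pow, RCLike.norm_conj]
              exact mul_le_of_le_one_right (by positivity) (norm_sub_gaussInt_gaussRound_le _)
          _ = n * ‖h k 0‖ ^ 2 := by simp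
      have h3 : -Real.log (π (z W)) ≤ n * (Real.log P + (Real.log 16 + 3)) +
          (∑ i, ‖x W i‖ ^ 2) / (2 * P) := by
        simp only [π]
        rw [Real.log_prod fun i _ => (gaussWeight_pos P _).ne', ← Finset.sum_neg_distrib]
        refine (Finset.sum_le_sum fun i _ => neg_log_gaussWeight_gaussRound_le hP (x W i)).trans
          (le_of_eq ?_)
        rw [Finset.sum_add_distrib, ← Finset.sum_div, Finset.sum_const, Finset.card_univ,
          Fintype.card_fin, nsmul_eq_mul]
      linarith
    have h1 := Finset.sum_le_sum fun W (_ : W ∈ Finset.univ) => hW W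
    rw [Finset.sum_add_distrib, ← Finset.sum_div] at h1
    have h2 := hpow d hd
    rw [div_le_iff₀ hM] at h2
    simp only [Finset.univ_unique, Fin.default_eq_zero, Finset.sum_singleton] at h2
    have h3 : (∑ W, ∑ i, ‖x W i‖ ^ 2) / (2 * P) ≤ n * Fintype.card (Library N F) := by
      rw [div_le_iff₀ (by linarith)]
      refine le_trans h2 ?_
      have : 0 ≤ (n : ℝ) * P * Fintype.card (Library N F) := by positivity
      linarith
    rw [div_le_iff₀ hM]
    refine h1.trans ?_
    simp only [Finset.sum_const, Finset.card_univ, nsmul_eq_mul]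
    linarith
  have hlog : Real.log (1 + (1 / 2) ^ J.card * Real.exp (J.card * Real.log 2 + κ)) ≤
      κ + Real.exp (-κ) := by
    have h1 : (1 / 2 : ℝ) ^ J.card * Real.exp (J.card * Real.log 2 + κ) = Real.exp κ := by
      rw [Real.exp_add, Real.exp_nat_mul, Real.exp_log two_pos, ← mul_assoc, ← mul_pow]
      norm_num
    have h2 : 1 + Real.exp κ = Real.exp κ * (1 + Real.exp (-κ)) := by
      rw [mul_add, ← Real.exp_add]; simp [add_comm]
    rw [h1, h2, Real.log_mul (Real.exp_pos _).ne' (by positivity), Real.log_exp]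
    have := Real.log_le_sub_one_of_pos (by positivity : 0 < 1 + Real.exp (-κ))
    linarith
  have hl : 0 ≤ J.card * Real.log 2 + κ := by
    have := Real.log_nonneg one_le_two
    positivity
  have := mul_le_mul_of_nonneg_left hsucc hl
  linarith

end Capacity

/-! ### Counting chain bits over orderings and demands. -/

section Averaging

/-- In a uniformly random ordering, `k` precedes all elements of `S` with probability
`1 / (|S| + 1)`. -/
theorem card_precedes {U : Type*} [Fintype U] [DecidableEq U] {K : ℕ} (S : Finset U) (k : U)
    (hk : k ∉ S) :
    (Finset.univ.filter fun σ : U ≃ Fin K => ∀ j, σ j ≤ σ k → j ∉ S).card * (S.card + 1) =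
      Fintype.card (U ≃ Fin K) := by
  classical
  let X : U → Finset (U ≃ Fin K) := fun e =>
    Finset.univ.filter fun σ => ∀ j ∈ insert k S, σ e ≤ σ j
  have hXk : (Finset.univ.filter fun σ : U ≃ Fin K => ∀ j, σ j ≤ σ k → j ∉ S) = X k := by
    ext σ
    simp only [X, Finset.mem_filter, Finset.mem_univ, true_and, Finset.mem_insert]
    constructor
    · rintro h j (rfl | hj)
      · exact le_rfl
      · exact le_of_not_ge fun hle => h j hle hj
    · intro h j hle hj
      have := σ.injective (le_antisymm hle (h j (Or.inr hj)))
      exact hk (this ▸ hj)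
  -- Exchanging `e` and `k` before ordering shows that each of the `S.card + 1` elements is equally
  -- often the first.
  have hXe : ∀ e ∈ insert k S, (X e).card = (X k).card := by
    intro e he
    have hmem : ∀ j ∈ insert k S, Equiv.swap e k j ∈ insert k S := by
      intro j hj
      rcases eq_or_ne j e with rfl | hje
      · rw [Equiv.swap_apply_left]; exact Finset.mem_insert_self _ _
      rcases eq_or_ne j k with rfl | hjk
      · rw [Equiv.swap_apply_right]; exact he
      · rwa [Equiv.swap_apply_of_ne_of_ne hje hjk]
    refine Finset.card_bij (fun σ _ => (Equiv.swap e k).trans σ) (fun σ hσ => ?_)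
      (fun σ _ σ' _ h => ?_) fun σ hσ => ⟨(Equiv.swap e k).trans σ, ?_, ?_⟩
    · refine Finset.mem_filter.2 ⟨Finset.mem_univ _, fun j hj => ?_⟩
      simp only [Equiv.trans_apply, Equiv.swap_apply_right]
      exact (Finset.mem_filter.1 hσ).2 _ (hmem j hj)
    · refine Equiv.ext fun u => ?_
      have := congrArg (fun τ => τ (Equiv.swap e k u)) h
      simpa using this
    · refine Finset.mem_filter.2 ⟨Finset.mem_univ _, fun j hj => ?_⟩
      simp only [Equiv.trans_apply, Equiv.swap_apply_left]
      exact (Finset.mem_filter.1 hσ).2 _ (hmem j hj)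
    · ext u
      simp
  have hunion : (insert k S).biUnion X = Finset.univ := by
    ext σ
    simp only [Finset.mem_biUnion, Finset.mem_univ, iff_true]
    obtain ⟨e, he, hmin⟩ := Finset.exists_min_image (insert k S) σ ⟨k, Finset.mem_insert_self _ _⟩
    exact ⟨e, he, Finset.mem_filter.2 ⟨Finset.mem_univ _, hmin⟩⟩
  have hdisj : ∀ e ∈ insert k S, ∀ e' ∈ insert k S, e ≠ e' → Disjoint (X e) (X e') := by
    intro e he e' he' hne
    rw [Finset.disjoint_left]
    intro σ hσ hσ'
    exact hne (σ.injective (le_antisymm ((Finset.mem_filter.1 hσ).2 e' he')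
      ((Finset.mem_filter.1 hσ').2 e he)))
  have h1 := Finset.card_biUnion hdisj
  rw [hunion, Finset.sum_congr rfl hXe, Finset.sum_const, Finset.card_insert_of_notMem hk,
    smul_eq_mul, Finset.card_univ] at h1
  rw [hXk, h1, mul_comm]

/-- The bits that are recovered when the users decode in the order `σ`, each using the files
decoded before. -/
def chainBits {U : Type*} [Fintype U] {N F K : ℕ} (cache : U → Finset (Fin N × Fin F))
    (d : U → Fin N) (σ : U ≃ Fin K) : Finset (Fin N × Fin F) :=
  open Classical in
  Finset.univ.biUnion fun k => Finset.univ.filter fun p => p.1 = d k ∧ ∀ j, σ j ≤ σ k → p ∉ cache j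

theorem Scheme.recoverable_chainBits {L K₁ K₂ N F n K : ℕ} (s : Scheme L K₁ K₂ N F n)
    (d : User K₁ K₂ → Fin N) (σ : User K₁ K₂ ≃ Fin K) :
    s.Recoverable d (chainBits s.cache d σ) := by
  classical
  intro W W' hoff hdec
  have hmem : ∀ p ∈ chainBits s.cache d σ, ∃ k, p.1 = d k ∧ ∀ j, σ j ≤ σ k → p ∉ s.cache j := by
    intro p hp
    simpa only [chainBits, Finset.mem_biUnion, Finset.mem_filter, Finset.mem_univ, true_and] using hp
  have hfile : ∀ r, ∀ k, σ k = r → W (d k) = W' (d k) := by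
    intro r
    induction r using WellFoundedLT.induction with
    | ind r ih =>
      intro k hk
      refine hdec k fun p hp => ?_
      by_cases hpJ : p ∈ chainBits s.cache d σ
      · obtain ⟨k', hk', hc⟩ := hmem p hpJ
        -- A chain bit cached by `k` must belong to a file requested by a user before `k`, which the
        -- induction has already settled.
        have hlt : σ k' < r := by
          rw [← hk]
          exact lt_of_not_ge fun hle => hc k hle hp
        rw [hk', ih _ hlt k' rfl]
      · exact hoff p hpJ
  ext i f
  by_cases hpJ : (i, f) ∈ chainBits s.cache d σ
  · obtain ⟨k, hk, -⟩ := hmem _ hpJ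
    simp only at hk
    rw [hk, hfile _ k rfl]
  · rw [hoff _ hpJ]

theorem card_chainBits {U : Type*} [Fintype U] [DecidableEq U] {N F K : ℕ}
    (cache : U → Finset (Fin N × Fin F)) (d : U → Fin N) (hd : Function.Injective d)
    (σ : U ≃ Fin K) :
    (chainBits cache d σ).card =
      ∑ k, ∑ f, if ∀ j, σ j ≤ σ k → (d k, f) ∉ cache j then 1 else 0 := by
  classical
  rw [chainBits, Finset.card_biUnion]
  · refine Finset.sum_congr rfl fun k _ => ?_
    rw [Finset.card_filter, Fintype.sum_prod_type, Finset.sum_eq_single (d k)]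
    · refine Finset.sum_congr rfl fun f _ => ?_
      simp
    · intro i _ hi
      simp [hi]
    · simp
  · intro k _ k' _ hne
    refine Finset.disjoint_left.2 ?_
    intro p hp hp'
    exact hne (hd ((Finset.mem_filter.1 hp).2.1.symm.trans (Finset.mem_filter.1 hp').2.1))

/-- Convexity of `s ↦ (K - s) / (s + 1)`; the gap to the tangent at `t` is an explicit nonnegative
fraction. It makes the average depend on the total cache size only. -/
theorem tangent_le (K t s : ℝ) (hK : 0 ≤ K) (ht : 0 ≤ t) (hs : 0 ≤ s) :
    (K - t) / (t + 1) - (K + 1) / (t + 1) ^ 2 * (s - t) ≤ (K - s) / (s + 1) := by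
  have h : (K - s) / (s + 1) - ((K - t) / (t + 1) - (K + 1) / (t + 1) ^ 2 * (s - t)) =
      (K + 1) * (s - t) ^ 2 / ((t + 1) ^ 2 * (s + 1)) := by
    field_simp
    ring
  have : 0 ≤ (K + 1) * (s - t) ^ 2 / ((t + 1) ^ 2 * (s + 1)) := by positivity
  linarith

/-- Averaging over cyclic shifts of the demands and all orderings of the users. -/
theorem exists_card_chainBits_ge {U : Type*} [Fintype U] [DecidableEq U] [Nonempty U] {N F : ℕ}
    (hN : Fintype.card U ≤ N) (cache : U → Finset (Fin N × Fin F)) (t : ℝ) (ht : 0 ≤ t)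
    (hcache : ∑ k, ((cache k).card : ℝ) ≤ t * (N * F)) :
    ∃ d : U → Fin N, Function.Injective d ∧ ∃ σ : U ≃ Fin (Fintype.card U),
      F * ((Fintype.card U - t) / (t + 1)) ≤ (chainBits cache d σ).card := by
  classical
  set K := Fintype.card U with hK
  have hK0 : 0 < K := Fintype.card_pos
  have : NeZero N := ⟨by omega⟩
  let e : U → Fin N := fun k => Fin.castLE hN (Fintype.equivFin U k)
  have he : Function.Injective e :=
    (Fin.castLE_injective hN).comp (Fintype.equivFin U).injective
  -- Over all shifts each user requests each file exactly once, so the sum over `r` and the bits of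
  -- a file becomes a sum over all library bits.
  let d : Fin N → U → Fin N := fun r k => e k + r
  have hd : ∀ r, Function.Injective (d r) := fun r k k' h => he (add_right_cancel h)
  have hne : Nonempty (U ≃ Fin K) := ⟨Fintype.equivFin U⟩
  obtain ⟨E, hE⟩ : ∃ E : ℝ, E = (Fintype.card (U ≃ Fin K) : ℕ) := ⟨_, rfl⟩
  have hE0 : 0 < E := by rw [hE]; exact_mod_cast Fintype.card_pos
  let S : Fin N × Fin F → Finset U := fun b => Finset.univ.filter fun k => b ∈ cache k
  -- A bit cached by the users in `S b` is counted for each of the other `K - (S b).card` users, in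
  -- a fraction `1 / ((S b).card + 1)` of the orderings.
  have htotal : ∑ x : Fin N × (U ≃ Fin K), ((chainBits cache (d x.1) x.2).card : ℝ) =
      ∑ b, ((K : ℝ) - (S b).card) / ((S b).card + 1) * E := by
    calc ∑ x : Fin N × (U ≃ Fin K), ((chainBits cache (d x.1) x.2).card : ℝ)
        = ∑ r, ∑ σ : U ≃ Fin K, ∑ k, ∑ f,
            if ∀ j, σ j ≤ σ k → (e k + r, f) ∉ cache j then (1 : ℝ) else 0 := by
          rw [Fintype.sum_prod_type]
          refine Finset.sum_congr rfl fun r _ => Finset.sum_congr rfl fun σ _ => ?_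
          rw [card_chainBits cache (d r) (hd r) σ]
          push_cast
          rfl
      _ = ∑ σ : U ≃ Fin K, ∑ k, ∑ r, ∑ f,
            if ∀ j, σ j ≤ σ k → (e k + r, f) ∉ cache j then (1 : ℝ) else 0 := by
          rw [Finset.sum_comm]
          exact Finset.sum_congr rfl fun σ _ => Finset.sum_comm
      _ = ∑ σ : U ≃ Fin K, ∑ k, ∑ b,
            if ∀ j, σ j ≤ σ k → b ∉ cache j then (1 : ℝ) else 0 := by
          refine Finset.sum_congr rfl fun σ _ => Finset.sum_congr rfl fun k _ => ?_
          rw [Fintype.sum_prod_type]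
          exact Equiv.sum_comp (Equiv.addLeft (e k)) fun i =>
            ∑ f, if ∀ j, σ j ≤ σ k → (i, f) ∉ cache j then (1 : ℝ) else 0
      _ = ∑ b, ∑ k, ∑ σ : U ≃ Fin K,
            if ∀ j, σ j ≤ σ k → j ∉ S b then (1 : ℝ) else 0 := by
          rw [Finset.sum_comm]
          simp_rw [Finset.sum_comm (s := (Finset.univ : Finset (U ≃ Fin K)))]
          rw [Finset.sum_comm]
          simp [S]
      _ = _ := by
          refine Finset.sum_congr rfl fun b _ => ?_
          have hin : ∀ k, (∑ σ : U ≃ Fin K, if ∀ j, σ j ≤ σ k → j ∉ S b then (1 : ℝ) else 0) =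
              if k ∈ S b then 0 else E / ((S b).card + 1) := by
            intro k
            rw [← Finset.sum_filter, Finset.sum_const, nsmul_eq_mul, mul_one]
            split_ifs with hk
            · rw [Nat.cast_eq_zero, Finset.card_eq_zero, Finset.filter_eq_empty_iff]
              exact fun σ _ h => h k le_rfl hk
            · rw [eq_div_iff (by positivity), hE]
              exact_mod_cast card_precedes (K := K) (S b) k hk
          simp_rw [hin]
          rw [Finset.sum_ite, Finset.sum_const_zero, zero_add, Finset.sum_const, nsmul_eq_mul]
          have h1 : ((Finset.univ.filter fun k => k ∉ S b).card : ℝ) = K - (S b).card := by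
            have h2 := Finset.card_filter_add_card_filter_not (s := (Finset.univ : Finset U))
              (fun k => k ∈ S b)
            rw [Finset.filter_univ_mem, Finset.card_univ, ← hK] at h2
            rw [← h2]
            push_cast
            ring
          rw [h1]
          ring
  have hsumS : ∑ b, ((S b).card : ℝ) = ∑ k, ((cache k).card : ℝ) := by
    have : ∀ b, ((S b).card : ℝ) = ∑ k, if b ∈ cache k then (1 : ℝ) else 0 := fun b => by
      rw [← Finset.sum_filter, Finset.sum_const, nsmul_eq_mul, mul_one]
    simp_rw [this]
    rw [Finset.sum_comm]
    refine Finset.sum_congr rfl fun k _ => ?_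
    rw [← Finset.sum_filter, Finset.sum_const, nsmul_eq_mul, mul_one, Finset.filter_univ_mem]
  have hlower : ∑ _x : Fin N × (U ≃ Fin K), F * ((K - t) / (t + 1)) ≤
      ∑ x : Fin N × (U ≃ Fin K), ((chainBits cache (d x.1) x.2).card : ℝ) := by
    rw [htotal]
    have h1 := Finset.sum_le_sum fun b (_ : b ∈ (Finset.univ : Finset (Fin N × Fin F))) =>
      tangent_le K t (S b).card (Nat.cast_nonneg _) ht (Nat.cast_nonneg _)
    rw [Finset.sum_sub_distrib, ← Finset.mul_sum, Finset.sum_sub_distrib, hsumS] at h1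
    simp only [Finset.sum_const, Finset.card_univ, Fintype.card_prod, Fintype.card_fin,
      nsmul_eq_mul] at h1 ⊢
    push_cast at h1 ⊢
    have h2 : 0 ≤ ((K : ℝ) + 1) / (t + 1) ^ 2 * (t * (N * F) - ∑ k, ((cache k).card : ℝ)) :=
      mul_nonneg (by positivity) (by linarith)
    have h3 : N * F * ((K - t) / (t + 1)) ≤ ∑ b, ((K : ℝ) - (S b).card) / ((S b).card + 1) := by
      nlinarith
    have := mul_le_mul_of_nonneg_right h3 hE0.le
    rw [Finset.sum_mul] at this
    rw [← hE]
    linarith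
  obtain ⟨x, -, hx⟩ := Finset.exists_le_of_sum_le ⟨(0, Classical.arbitrary _), Finset.mem_univ _⟩
    hlower
  exact ⟨d x.1, hd x.1, x.2, hx⟩

end Averaging

/-! ### Assembly of converse, achievability and asymptotics. -/

section Main

theorem le_of_forall_mul_one_sub_le {X Y : ℝ} (hX : 0 ≤ X)
    (h : ∀ ε : ℝ, 0 < ε → ε < 1 → X * (1 - ε) ≤ 2 * ε + Y) : X ≤ Y := by
  refine le_of_forall_pos_le_add fun e he => ?_
  have h1 : 0 < min (1 / 2) (e / (X + 2)) := lt_min (by norm_num) (by positivity)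
  have h2 := h _ h1 ((min_le_left _ _).trans_lt (by norm_num))
  have h3 : min (1 / 2) (e / (X + 2)) * (X + 2) ≤ e := by
    rw [← le_div_iff₀ (by positivity)]
    exact min_le_right _ _
  linarith

/-- The converse for a single transmit antenna and uncoded placement. -/
theorem le_of_isAchievableDelay {K₁ K₂ N : ℕ} {γ₁ γ₂ t : ℝ} (hK : 0 < K₁ + K₂) (hN : K₁ + K₂ ≤ N)
    (ht0 : 0 ≤ t) (htK : t ≤ K₁ + K₂) (ht : K₁ * γ₁ + K₂ * γ₂ = t) (h : Channel 1 K₁ K₂) {T : ℝ}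
    (hT : IsAchievableDelay N γ₁ γ₂ h T) : ((K₁ + K₂ : ℕ) - t) / (t + 1) ≤ T := by
  classical
  obtain ⟨c, hc, hconv⟩ := recoverable_card_le h
  set Q : ℝ := ((K₁ + K₂ : ℕ) - t) / (t + 1) with hQ
  have hQ0 : 0 ≤ Q := div_nonneg (by push_cast; linarith) (by linarith)
  have hcardU : Fintype.card (User K₁ K₂) = K₁ + K₂ := by simp
  have : Nonempty (User K₁ K₂) := Fintype.card_pos_iff.1 (by omega)
  have hlog2 : 0 < Real.log 2 := Real.log_pos one_lt_two
  refine le_of_forall_pos_le_add fun δ hδ => ?_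
  have hfix : ∀ᶠ P : ℝ in atTop, Q ≤ (T + δ) * (1 + c / Real.log P) := by
    filter_upwards [hT δ hδ, eventually_gt_atTop 1] with P hP hP1
    have hlogP : 0 < Real.log P := Real.log_pos hP1
    have hmul : Q * Real.log 2 ≤ (T + δ) * (1 + c / Real.log P) * Real.log 2 := by
      refine le_of_forall_mul_one_sub_le (by positivity) fun ε hε hε1 => ?_
      -- The file size is not under control and may stay small, so additive constants must vanish
      -- too: `κ` makes `exp (-κ)` small, and then `η` makes `K * η * κ` small. The remainder `2 *
      -- ε` is at most `2 * ε * F` because `F ≥ 1`.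
      obtain ⟨κ, hκ0, hκ⟩ : ∃ κ : ℝ, 0 ≤ κ ∧ Real.exp (-κ) ≤ ε :=
        ⟨-Real.log ε, by linarith [Real.log_nonpos hε.le hε1.le], by
          rw [neg_neg, Real.exp_log hε]⟩
      obtain ⟨K, hKdef⟩ : ∃ K : ℝ, K = (Fintype.card (User K₁ K₂) : ℕ) := ⟨_, rfl⟩
      have hK0 : 0 < K := by rw [hKdef, hcardU]; exact_mod_cast hK
      set η := ε / (K * (κ + 1)) with hη
      have hη0 : 0 < η := by positivity
      have hη1 : K * η * (κ + 1) = ε := by rw [hη]; field_simp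
      have hKη : 0 < K * η := by positivity
      obtain ⟨F, n, s, hF, ⟨hc₁, hc₂⟩, hpow, herr, hdelay⟩ := hP η hη0
      have hF1 : (1 : ℝ) ≤ F := by exact_mod_cast hF
      have hcache : ∑ k, ((s.cache k).card : ℝ) ≤ t * (N * F) := by
        rw [Fintype.sum_sum_type]
        have h1 := Finset.sum_le_sum fun i (_ : i ∈ Finset.univ) => hc₁ i
        have h2 := Finset.sum_le_sum fun j (_ : j ∈ Finset.univ) => hc₂ j
        simp only [Finset.sum_const, Finset.card_univ, Fintype.card_fin, nsmul_eq_mul] at h1 h2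
        rw [← ht]
        linarith
      obtain ⟨d, hd, σ, hJ⟩ := exists_card_chainBits_ge (by omega) s.cache t ht0 hcache
      have hmain := hconv N F n s P hP1.le hpow d hd η (herr d hd) _
        (s.recoverable_chainBits d σ) κ hκ0
      obtain ⟨J, hJdef⟩ : ∃ J : ℝ, J = ((chainBits s.cache d σ).card : ℕ) := ⟨_, rfl⟩
      rw [← hJdef] at hJ hmain
      rw [hcardU, ← hQ] at hJ
      rw [← hKdef] at hmain
      have hFQ : 0 ≤ F * Q := by positivity
      have hKηε : K * η ≤ ε := by nlinarith
      have h1 : F * Q * Real.log 2 * (1 - ε) ≤ J * Real.log 2 * (1 - K * η) := by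
        refine mul_le_mul (mul_le_mul_of_nonneg_right hJ hlog2.le) (by linarith) (by linarith) ?_
        exact mul_nonneg (hFQ.trans hJ) hlog2.le
      have h2 : F * Q * Real.log 2 * (1 - ε) ≤ 2 * ε + n * (Real.log P + c) := by
        nlinarith
      have h3 : n * Real.log P ≤ (T + δ) * Real.log 2 * F := by
        rw [div_le_iff₀ (by linarith), Real.logb, ← mul_div_assoc, div_le_iff₀ hlog2] at hdelay
        linarith
      have h4 : n * (Real.log P + c) ≤ (T + δ) * (1 + c / Real.log P) * Real.log 2 * F := by
        have h5 : n * (Real.log P + c) = n * Real.log P * (1 + c / Real.log P) := by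
          field_simp
        rw [h5]
        have := mul_le_mul_of_nonneg_right h3 (by positivity : 0 ≤ 1 + c / Real.log P)
        linarith
      have h6 : F * (Q * Real.log 2 * (1 - ε)) ≤
          F * (2 * ε + (T + δ) * (1 + c / Real.log P) * Real.log 2) := by
        nlinarith
      exact le_of_mul_le_mul_left h6 (by linarith)
    exact le_of_mul_le_mul_right hmul hlog2
  have hlim : Tendsto (fun P : ℝ => (T + δ) * (1 + c / Real.log P)) atTop (𝓝 ((T + δ) * (1 + 0))) :=
    ((Real.tendsto_log_atTop.const_div_atTop c).const_add 1).const_mul _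
  have := ge_of_tendsto hlim hfix
  linarith

theorem singleStreamDelay_eq {K t : ℕ} {γ : ℝ} (ht : (K : ℝ) * γ = t) :
    singleStreamDelay K γ = (K - t) / (t + 1) := by
  rw [singleStreamDelay, ht, ← ht]
  ring_nf

/-- The quotient by `1 / γ` is `(1 - γ) * (1 - (1 + K * γ)⁻¹)`, and both factors tend to `1`. -/
theorem singleStreamDelay_isEquivalent :
    (fun p : ℕ × ℝ => singleStreamDelay p.1 p.2) ~[smallCacheRegime] fun p => 1 / p.2 := by
  have h1 : Tendsto (fun p : ℕ × ℝ => (p.1 : ℝ) * p.2) smallCacheRegime atTop :=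
    tendsto_comap.mono_left inf_le_left
  have h2 : Tendsto (fun p : ℕ × ℝ => p.2) smallCacheRegime (𝓝[>] 0) :=
    tendsto_comap.mono_left inf_le_right
  have h3 : Tendsto (fun p : ℕ × ℝ => p.2) smallCacheRegime (𝓝 0) :=
    h2.mono_right nhdsWithin_le_nhds
  have h4 : Tendsto (fun p : ℕ × ℝ => (1 - p.2) * (1 - (1 + (p.1 : ℝ) * p.2)⁻¹)) smallCacheRegime
      (𝓝 ((1 - 0) * (1 - 0))) :=
    (h3.const_sub 1).mul ((tendsto_inv_atTop_zero.comp
      (tendsto_atTop_add_const_left _ 1 h1)).const_sub 1)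
  refine isEquivalent_of_tendsto_one ?_
  rw [sub_zero, mul_one] at h4
  refine h4.congr' ?_
  filter_upwards [h1.eventually_gt_atTop 0, h2.eventually self_mem_nhdsWithin] with p hp hp2
  have hp2' : 0 < p.2 := hp2
  simp only [Pi.div_apply, singleStreamDelay]
  have : 1 + (p.1 : ℝ) * p.2 ≠ 0 := by positivity
  field_simp
  ring

theorem isAchievableDelay_singleStreamDelay {L K₁ K₂ N t : ℕ} {γ₁ : ℝ}
    (hL : 1 ≤ L) (hγ₀ : 0 < γ₁) (hγ₁ : γ₁ < 1) (hK₁ : 1 ≤ K₁) (ht : (K₁ : ℝ) * γ₁ = t)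
    (hK₂ : (K₂ : ℝ) ≤ ((L : ℝ) - 1) * singleStreamDelay K₁ γ₁)
    (hT : K₂ = 0 ∨ 1 ≤ singleStreamDelay K₁ γ₁) (H : Channel L K₁ K₂) (hH : InGeneralPosition H) :
    IsAchievableDelay N γ₁ 0 H (singleStreamDelay K₁ γ₁) := by
  have hK₁' : (0 : ℝ) < K₁ := by exact_mod_cast hK₁
  have ht0 : 0 < t := by
    have : (0 : ℝ) < t := by rw [← ht]; positivity
    exact_mod_cast this
  have htK : t < K₁ := by
    have : (t : ℝ) < K₁ := by rw [← ht]; nlinarith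
    exact_mod_cast this
  obtain ⟨g, hg⟩ := Nat.exists_eq_add_of_lt htK
  have hgr : (K₁ : ℝ) - t = ((g + 1 : ℕ) : ℝ) := by rw [hg]; push_cast; ring
  rw [singleStreamDelay_eq ht, hgr] at hK₂ hT ⊢
  have ht1 : (0 : ℝ) < t + 1 := by positivity
  refine isAchievableDelay_of_schedule γ₁ hL ht (by omega) (Nat.succ_pos g) ht0 ?_ ?_ H hH
  · rw [← mul_div_assoc, le_div_iff₀ ht1] at hK₂
    obtain ⟨r, rfl⟩ := Nat.exists_eq_add_of_le' hL
    push_cast at hK₂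
    rw [add_sub_cancel_right] at hK₂
    rw [Nat.add_sub_cancel]
    exact_mod_cast hK₂
  · refine hT.imp_right fun h => ?_
    rw [one_le_div ht1] at h
    exact_mod_cast h

end Main

theorem corollary2 (L K₁ K₂ N t : ℕ) (γ₁ : ℝ)
    (hL : 1 ≤ L) (hK₁ : 1 ≤ K₁) (hN : K₁ + K₂ ≤ N)
    (hγ₀ : 0 < γ₁) (hγ₁ : γ₁ < 1) (ht : (K₁ : ℝ) * γ₁ = t)
    (hK₂ : (K₂ : ℝ) ≤ ((L : ℝ) - 1) * singleStreamDelay K₁ γ₁)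
    (hT : K₂ = 0 ∨ 1 ≤ singleStreamDelay K₁ γ₁) :
    -- the optimal delay of the initial single-antenna system, without cache-less users
    (∀ h : Channel 1 K₁ 0, InGeneralPosition h →
      IsLeast {T : ℝ | IsAchievableDelay N γ₁ 0 h T} (singleStreamDelay K₁ γ₁)) ∧
    -- the same delay, with `L` antennas and `K₂` additional cache-less users
    (∀ H : Channel L K₁ K₂, InGeneralPosition H →
      IsAchievableDelay N γ₁ 0 H (singleStreamDelay K₁ γ₁)) ∧
    -- the approximation of the number of additional users, with its relative error
    ((L : ℝ) - 1) * singleStreamDelay K₁ γ₁ =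
      ((L : ℝ) - 1) / γ₁ * (1 - (γ₁ + (1 - γ₁) / (1 + K₁ * γ₁))) ∧
    (fun p : ℕ × ℝ => ((L : ℝ) - 1) * singleStreamDelay p.1 p.2) ~[smallCacheRegime]
      (fun p : ℕ × ℝ => ((L : ℝ) - 1) / p.2) := by
  have hK₁' : (0 : ℝ) < K₁ := by exact_mod_cast hK₁
  have htK : (t : ℝ) ≤ K₁ := by rw [← ht]; nlinarith
  have hT0 : 0 ≤ singleStreamDelay K₁ γ₁ := by
    rw [singleStreamDelay_eq ht]
    exact div_nonneg (by linarith) (by positivity)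
  refine ⟨fun h hh => ⟨?_, fun T hT' => ?_⟩, fun H hH => ?_, ?_, ?_⟩
  · exact isAchievableDelay_singleStreamDelay le_rfl hγ₀ hγ₁ hK₁ ht (by simp) (Or.inl rfl) h hh
  · rw [singleStreamDelay_eq ht]
    have := le_of_isAchievableDelay (t := t) (by omega) (by omega) (Nat.cast_nonneg t)
      (by simpa using htK) (by simpa using ht) h hT'
    simpa using this
  · exact isAchievableDelay_singleStreamDelay hL hγ₀ hγ₁ hK₁ ht hK₂ hT H hH
  · have : (0 : ℝ) < 1 + K₁ * γ₁ := by positivity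
    rw [singleStreamDelay]
    field_simp
    ring
  · have := (IsEquivalent.refl (u := fun _ : ℕ × ℝ => (L : ℝ) - 1) (l := smallCacheRegime)).mul
      singleStreamDelay_isEquivalent
    refine this.congr_right (Eventually.of_forall fun p => ?_)
    simp [div_eq_mul_inv]
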